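/- **Proposition 4.6.** For a Hermitian $n\times n$ complex matrix $X$ let $\lambda_1(X)\ge\dots\ge\lambda_n(X)$ be its eigenvalues in decreasing order, counted with multiplicities. For positive semidefinite $n\times n$ matrices $A,B$ and $0<\alpha\le 1$ let $$A\,\#_\alpha\,B=\lim_{\varepsilon\searrow0}(A+\varepsilon I)\,\#_\alpha\,(B+\varepsilon I),\qquad\text{where } X\,\#_\alpha\,Y=X^{1/2}(X^{-1/2}YX^{-1/2})^\alpha X^{1/2}\text{ for positive definite } X,Y,$$ be the weighted geometric mean. Powers of positive semidefinite matrices and of nonnegative numbers use the convention $0^0=1$, so that $A^0=I$. Let $A$ be a positive semidefinite $n\times n$ complex matrix, $E$ an orthogonal projection in the $n\times n$ complex matrices with $\operatorname{rank}E=l$, $0<\alpha\le 1$, $p_0,p_1\ge 0$ and $0\le\theta\le 1$. Then for every $p\ge0$ the limit defining $A^p\,\#_\alpha\,E$ exists, $A^p\,\#_\alpha\,E$ is positive semidefinite, and $E(A^p\,\#_\alpha\,E)E=A^p\,\#_\alpha\,E$ (so its eigenvalues on the range of $E$ are $\lambda_1,\dots,\lambda_l$ of it). Moreover $$\bigl(\lambda_i(A^{(1-\theta)p_0+\theta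 p_1}\,\#_\alpha\,E)\bigr)_{i=1}^l\prec^{w(\log)}\bigl(\lambda_i^{1-\theta}(A^{p_0}\,\#_\alpha\,E)\,\lambda_i^{\theta}(A^{p_1}\,\#_\alpha\,E)\bigr)_{i=1}^l,$$ that is, for every $1\le k\le l$, $$\prod_{i=l-k+1}^{l}\lambda_i(A^{(1-\theta)p_0+\theta p_1}\,\#_\alpha\,E)\ \ge\ \prod_{i=l-k+1}^{l}\lambda_i^{1-\theta}(A^{p_0}\,\#_\alpha\,E)\,\lambda_i^{\theta}(A^{p_1}\,\#_\alpha\,E).$$ -/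

import Mathlib

open scoped Topology ComplexOrder

namespace LogMaj

/-- The power `A ^ p` of a positive semidefinite complex matrix, by functional calculus with
`x ↦ x ^ p` on the eigenvalues (so `A ^ 0 = I`, with the convention `0 ^ 0 = 1`, and negative
powers are the usual ones when `A` is positive definite). -/
noncomputable def mpow {n : ℕ} (A : Matrix (Fin n) (Fin n) ℂ) (p : ℝ) :
    Matrix (Fin n) (Fin n) ℂ :=
  cfc (fun x : ℝ => x ^ p) A

/-- `A^{1/2} (A^{-1/2} B A^{-1/2})^α A^{1/2}`: the weighted geometric mean of `A` and `B`
for `A` positive definite and `B` positive semidefinite. -/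
noncomputable def geomMeanPos {n : ℕ} (α : ℝ) (A B : Matrix (Fin n) (Fin n) ℂ) :
    Matrix (Fin n) (Fin n) ℂ :=
  mpow A (1 / 2) * mpow (mpow A (-(1 / 2)) * B * mpow A (-(1 / 2))) α * mpow A (1 / 2)

/-- `(A + ε I) #_α (B + ε I)`, the approximants of the weighted geometric mean. -/
noncomputable def geomMeanApprox {n : ℕ} (α : ℝ) (A B : Matrix (Fin n) (Fin n) ℂ) (ε : ℝ) :
    Matrix (Fin n) (Fin n) ℂ :=
  geomMeanPos α (A + (ε : ℂ) • (1 : Matrix (Fin n) (Fin n) ℂ))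
    (B + (ε : ℂ) • (1 : Matrix (Fin n) (Fin n) ℂ))

/-- The weighted geometric mean `A #_α B` of positive semidefinite matrices,
`lim_{ε ↘ 0} (A + ε I) #_α (B + ε I)`. -/
noncomputable def geomMean {n : ℕ} (α : ℝ) (A B : Matrix (Fin n) (Fin n) ℂ) :
    Matrix (Fin n) (Fin n) ℂ :=
  Filter.limUnder (𝓝[>] (0 : ℝ)) (geomMeanApprox α A B)

/-- `eig X i` (for `i < n`) is the `(i + 1)`-st eigenvalue of the Hermitian matrix `X`, the
eigenvalues being listed in decreasing order with multiplicities. -/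
noncomputable def eig {n : ℕ} (X : Matrix (Fin n) (Fin n) ℂ) (i : ℕ) : ℝ :=
  open Classical in
  if h : X.IsHermitian ∧ i < n then h.1.eigenvalues₀ ⟨i, by simpa using h.2⟩ else 0

/-- Log-supermajorization `a ≺^{w(log)} b` of nonnegative vectors listed in decreasing order:
for each `1 ≤ k ≤ l`, the product of the last `k` entries of `a` is at least the product of the
last `k` entries of `b`. -/
def LogSupermajorizedBy {l : ℕ} (a b : Fin l → ℝ) : Prop :=
  ∀ k : ℕ, 1 ≤ k → k ≤ l →
    ∏ i ∈ Finset.univ.filter (fun i : Fin l => l - k ≤ i.val), b i ≤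
      ∏ i ∈ Finset.univ.filter (fun i : Fin l => l - k ≤ i.val), a i

end LogMaj

open scoped MatrixOrder Matrix.Norms.L2Operator Matrix

namespace LogMaj

/-! ### Functional calculus of Hermitian matrices -/

section FunctionalCalculus

variable {n m : ℕ}

/-! Write `E = V Vᴴ` with `V` an isometry. For positive definite `X`, the identity `(TᴴT)^α =
Tᴴ(TTᴴ)^(α-1)T` turns the mean of `X` and `E` into `V (Vᴴ X⁻¹ V)^(α-1) Vᴴ` (`geomMeanPos_eq`). So
the `k` smallest eigenvalues on the range of `E` are powers, with exponent `-(1-α) ≤ 0`, of the `k`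
largest eigenvalues of `H(p) = Vᴴ A^(-p) V` when `X = A^p`, and it suffices that the product of
those is logarithmically convex in `p`.

By Cauchy–Binet, the determinant of a compression of `H(p)` to `k` dimensions is a sum of terms `q
b^p` with `q ≥ 0` independent of `p`, hence log-convex by Hölder (`sum_mul_rpow_le`). Such a
determinant never exceeds the top-`k` product, and equals it on the top eigenvectors. Choosing these
at the interpolated exponent gives `prod_eig_compression_le`.

For singular `A`, the definition perturbs to `A^p + ε`, while the argument above needs `(A + ε)^p`.
Operator monotonicity reconciles them: the compressed mean has one limit along all positive definite
matrices above `A^p` (`exists_tendsto_of_monotone`), and this limit bounds it from below, which also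
supplies the inequalities needed as `ε ↘ 0`. -/

/-- A Hermitian matrix together with its functional calculus in diagonal form. -/
lemma exists_unitary_cfc_eq {A : Matrix (Fin n) (Fin n) ℂ} (hA : A.IsHermitian) :
    ∃ (U : Matrix (Fin n) (Fin n) ℂ) (d : Fin n → ℝ), Uᴴ * U = 1 ∧ U * Uᴴ = 1 ∧
      A = U * Matrix.diagonal (fun i => (d i : ℂ)) * Uᴴ ∧
      (∀ f : ℝ → ℝ, cfc f A = U * Matrix.diagonal (fun i => (f (d i) : ℂ)) * Uᴴ) ∧
      (∀ i, d i = hA.eigenvalues i) := by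
  refine ⟨hA.eigenvectorUnitary, hA.eigenvalues, ?_, ?_, ?_, ?_, fun _ => rfl⟩
  · exact Unitary.coe_star_mul_self hA.eigenvectorUnitary
  · exact Unitary.coe_mul_star_self hA.eigenvectorUnitary
  · conv_lhs => rw [hA.spectral_theorem, Unitary.conjStarAlgAut_apply]
    rfl
  · intro f
    rw [hA.cfc_eq f, Matrix.IsHermitian.cfc, Unitary.conjStarAlgAut_apply]
    rfl

/-- The functional calculus is compatible with intertwining relations `T A = B T`. -/
lemma mul_cfc_of_intertwines {A : Matrix (Fin n) (Fin n) ℂ} {B : Matrix (Fin m) (Fin m) ℂ}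
    (hA : A.IsHermitian) (hB : B.IsHermitian) {T : Matrix (Fin m) (Fin n) ℂ}
    (h : T * A = B * T) (f : ℝ → ℝ) : T * cfc f A = cfc f B * T := by
  obtain ⟨U, d, hU, hU', hAd, hAf, -⟩ := exists_unitary_cfc_eq hA
  obtain ⟨W, e, hW, hW', hBe, hBf, -⟩ := exists_unitary_cfc_eq hB
  have key : (Wᴴ * T * U) * Matrix.diagonal (fun i => (d i : ℂ)) =
      Matrix.diagonal (fun i => (e i : ℂ)) * (Wᴴ * T * U) := by
    have h1 : Wᴴ * (T * A) * U = Wᴴ * (B * T) * U := by rw [h]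
    rw [hAd, hBe] at h1
    calc _ = Wᴴ * T * U * Matrix.diagonal (fun i => (d i : ℂ)) * (Uᴴ * U) := by
          rw [hU, Matrix.mul_one]
      _ = Wᴴ * (T * (U * Matrix.diagonal (fun i => (d i : ℂ)) * Uᴴ)) * U := by
          simp only [Matrix.mul_assoc]
      _ = (Wᴴ * W) * Matrix.diagonal (fun i => (e i : ℂ)) * (Wᴴ * T * U) := by
          rw [h1]; simp only [Matrix.mul_assoc]
      _ = _ := by rw [hW, one_mul]
  have key' : (Wᴴ * T * U) * Matrix.diagonal (fun i => (f (d i) : ℂ)) =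
      Matrix.diagonal (fun i => (f (e i) : ℂ)) * (Wᴴ * T * U) := by
    ext i j
    have hij := congrFun (congrFun key i) j
    rw [Matrix.mul_diagonal, Matrix.diagonal_mul] at hij ⊢
    -- In the two eigenbases `T` has nonzero entries only where the eigenvalues agree, and there `f`
    -- agrees too.
    by_cases hde : d j = e i
    · rw [hde, mul_comm]
    · have : (Wᴴ * T * U) i j = 0 := by
        have h2 : (Wᴴ * T * U) i j * ((d j : ℂ) - e i) = 0 := by
          rw [mul_sub, hij]; ring
        rcases mul_eq_zero.mp h2 with h3 | h3
        · exact h3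
        · exact absurd (by exact_mod_cast sub_eq_zero.mp h3) hde
      rw [this]; simp
  rw [hAf, hBf]
  calc T * (U * Matrix.diagonal (fun i => (f (d i) : ℂ)) * Uᴴ)
      = (W * Wᴴ) * T * (U * Matrix.diagonal (fun i => (f (d i) : ℂ)) * Uᴴ) := by
        rw [hW', Matrix.one_mul]
    _ = W * ((Wᴴ * T * U) * Matrix.diagonal (fun i => (f (d i) : ℂ))) * Uᴴ := by
        simp only [Matrix.mul_assoc]
    _ = W * Matrix.diagonal (fun i => (f (e i) : ℂ)) * Wᴴ * T * (U * Uᴴ) := by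
        rw [key']; simp only [Matrix.mul_assoc]
    _ = _ := by rw [hU', Matrix.mul_one]

end FunctionalCalculus

/-! ### Powers of positive semidefinite matrices -/

section Powers

variable {n m : ℕ}

lemma mpow_eq_rpow {A : Matrix (Fin n) (Fin n) ℂ} (hA : 0 ≤ A) (p : ℝ) : mpow A p = A ^ p := by
  rw [CFC.rpow_eq_cfc_real hA]; rfl

lemma mpow_nonneg {A : Matrix (Fin n) (Fin n) ℂ} (hA : 0 ≤ A) (p : ℝ) : 0 ≤ mpow A p := by
  rw [mpow_eq_rpow hA]; exact CFC.rpow_nonneg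

lemma mpow_conjTranspose {A : Matrix (Fin n) (Fin n) ℂ} (hA : 0 ≤ A) (p : ℝ) :
    (mpow A p)ᴴ = mpow A p :=
  (Matrix.nonneg_iff_posSemidef.mp (mpow_nonneg hA p)).1

lemma mpow_zero {A : Matrix (Fin n) (Fin n) ℂ} (hA : 0 ≤ A) : mpow A 0 = 1 := by
  rw [mpow_eq_rpow hA, CFC.rpow_zero A]

lemma mpow_add {A : Matrix (Fin n) (Fin n) ℂ} (hA : A.PosDef) (p q : ℝ) :
    mpow A (p + q) = mpow A p * mpow A q := by
  have h0 : 0 ≤ A := Matrix.nonneg_iff_posSemidef.mpr hA.posSemidef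
  rw [mpow_eq_rpow h0, mpow_eq_rpow h0, mpow_eq_rpow h0, CFC.rpow_add hA.isUnit]

lemma mpow_one {A : Matrix (Fin n) (Fin n) ℂ} (hA : 0 ≤ A) : mpow A 1 = A := by
  rw [mpow_eq_rpow hA, CFC.rpow_one A]

lemma mpow_neg_mul {A : Matrix (Fin n) (Fin n) ℂ} (hA : A.PosDef) (p : ℝ) :
    mpow A (-p) * mpow A p = 1 := by
  rw [← mpow_add hA, neg_add_cancel, mpow_zero (Matrix.nonneg_iff_posSemidef.mpr hA.posSemidef)]

lemma mpow_mul_neg {A : Matrix (Fin n) (Fin n) ℂ} (hA : A.PosDef) (p : ℝ) :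
    mpow A p * mpow A (-p) = 1 := by
  rw [← mpow_add hA, add_neg_cancel, mpow_zero (Matrix.nonneg_iff_posSemidef.mpr hA.posSemidef)]

lemma mpow_neg_one {A : Matrix (Fin n) (Fin n) ℂ} (hA : A.PosDef) : mpow A (-1) = A⁻¹ := by
  have h := mpow_neg_mul hA 1
  rw [mpow_one (Matrix.nonneg_iff_posSemidef.mpr hA.posSemidef)] at h
  exact (Matrix.inv_eq_left_inv h).symm

lemma mpow_inv {A : Matrix (Fin n) (Fin n) ℂ} (hA : A.PosDef) (p : ℝ) :
    mpow A⁻¹ p = mpow A (-p) := by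
  have h0 : 0 ≤ A := Matrix.nonneg_iff_posSemidef.mpr hA.posSemidef
  have h1 : 0 ≤ A⁻¹ := Matrix.nonneg_iff_posSemidef.mpr hA.inv.posSemidef
  have h2 := mpow_neg_one hA
  rw [mpow_eq_rpow h1, ← h2, mpow_eq_rpow h0, mpow_eq_rpow h0, 
    CFC.rpow_rpow A (-1) p (by norm_num)
      (Matrix.isStrictlyPositive_iff_posDef.mpr hA)]
  simp

/-- The Löwner–Heinz inequality; it is the source of every monotonicity statement about means below.
-/
lemma mpow_mono {A B : Matrix (Fin n) (Fin n) ℂ} (hA : 0 ≤ A) (hAB : A ≤ B) {p : ℝ}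
    (hp : 0 ≤ p) (hp1 : p ≤ 1) : mpow A p ≤ mpow B p := by
  rw [mpow_eq_rpow hA, mpow_eq_rpow (hA.trans hAB)]
  exact CFC.rpow_le_rpow ⟨hp, hp1⟩ hAB

lemma inv_anti {A B : Matrix (Fin n) (Fin n) ℂ} (hA : A.PosDef) (hAB : A ≤ B) : B⁻¹ ≤ A⁻¹ := by
  have := CStarAlgebra.ringInverse_le_ringInverse hAB
    (Matrix.isStrictlyPositive_iff_posDef.mpr hA)
  rwa [← Matrix.nonsing_inv_eq_ringInverse, ← Matrix.nonsing_inv_eq_ringInverse] at this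

lemma posDef_of_le {A B : Matrix (Fin n) (Fin n) ℂ} (hA : A.PosDef) (hAB : A ≤ B) : B.PosDef :=
  Matrix.isStrictlyPositive_iff_posDef.mp
    ((Matrix.isStrictlyPositive_iff_posDef.mpr hA).of_le hAB)

lemma conj_le_conj {A B : Matrix (Fin n) (Fin n) ℂ} (hAB : A ≤ B) (R : Matrix (Fin n) (Fin m) ℂ) :
    Rᴴ * A * R ≤ Rᴴ * B * R := by
  rw [Matrix.le_iff] at hAB ⊢
  have := hAB.conjTranspose_mul_mul_same R
  rwa [Matrix.mul_sub, Matrix.sub_mul] at this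

lemma mpow_neg_anti {A B : Matrix (Fin n) (Fin n) ℂ} (hA : A.PosDef) (hAB : A ≤ B) {p : ℝ}
    (hp : 0 ≤ p) (hp1 : p ≤ 1) : mpow B (-p) ≤ mpow A (-p) := by
  have hB := posDef_of_le hA hAB
  rw [← mpow_inv hA, ← mpow_inv hB]
  exact mpow_mono (Matrix.nonneg_iff_posSemidef.mpr hB.inv.posSemidef) (inv_anti hA hAB) hp hp1

/-- Nonnegative powers are continuous on positive semidefinite matrices. -/
lemma tendsto_mpow {X : Type*} {l : Filter X} {F : X → Matrix (Fin n) (Fin n) ℂ}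
    {A : Matrix (Fin n) (Fin n) ℂ} (hF : Filter.Tendsto F l (𝓝 A)) (hF0 : ∀ᶠ x in l, 0 ≤ F x)
    (hA : 0 ≤ A) {p : ℝ} (hp : 0 ≤ p) :
    Filter.Tendsto (fun x => mpow (F x) p) l (𝓝 (mpow A p)) := by
  -- Eventually all spectra lie in one compact interval on which `x ↦ x ^ p` is continuous.
  have hspec : ∀ {B : Matrix (Fin n) (Fin n) ℂ}, 0 ≤ B → ‖B‖ ≤ ‖A‖ + 1 →
      spectrum ℝ B ⊆ Set.Icc 0 (‖A‖ + 1) := by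
    intro B hB hn x hx
    refine ⟨spectrum_nonneg_of_nonneg hB hx, ?_⟩
    have h2 : ‖x‖ ≤ ‖B‖ := by
      rcases Nat.eq_zero_or_pos n with hn0 | hn0
      · subst hn0
        exact absurd hx (by simp [spectrum.of_subsingleton])
      · have : Nonempty (Fin n) := ⟨⟨0, hn0⟩⟩
        simpa using spectrum.norm_le_norm_of_mem hx
    exact (le_abs_self x).trans (h2.trans hn)
  have hnorm : ∀ᶠ x in l, ‖F x‖ ≤ ‖A‖ + 1 :=
    (hF.norm.eventually (gt_mem_nhds (lt_add_one _))).mono fun _ h => h.le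
  refine Filter.Tendsto.cfc (𝕜 := ℝ) (p := IsSelfAdjoint) (s := Set.Icc 0 (‖A‖ + 1)) isCompact_Icc
    _ hF ?_ ?_ (hspec hA (by linarith [norm_nonneg A])) hA.isSelfAdjoint ?_
  · filter_upwards [hF0, hnorm] with x h1 h2 using hspec h1 h2
  · filter_upwards [hF0] with x h1 using h1.isSelfAdjoint
  · exact fun x _ => (Real.continuousAt_rpow_const x p (Or.inr hp)).continuousWithinAt

/-- `(T* T) ^ α = T* (T T*) ^ (α - 1) T`. -/
lemma mpow_conjTranspose_mul_self (T : Matrix (Fin m) (Fin n) ℂ) {α : ℝ} (hα : 0 < α) :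
    mpow (Tᴴ * T) α = Tᴴ * mpow (T * Tᴴ) (α - 1) * T := by
  have h0 : 0 ≤ Tᴴ * T := Matrix.nonneg_iff_posSemidef.mpr (Matrix.posSemidef_conjTranspose_mul_self T)
  have h1 : (T * Tᴴ).IsHermitian := Matrix.isHermitian_mul_conjTranspose_self T
  have h2 : (Tᴴ * T).IsHermitian := Matrix.isHermitian_conjTranspose_mul_self T
  have h3 : Tᴴ * mpow (T * Tᴴ) (α - 1) = mpow (Tᴴ * T) (α - 1) * Tᴴ :=
    mul_cfc_of_intertwines h1 h2 (by simp only [Matrix.mul_assoc]) _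
  rw [h3, Matrix.mul_assoc]
  obtain ⟨U, d, hU, hU', hAd, hAf, hd⟩ := exists_unitary_cfc_eq h2
  have hd0 : ∀ i, 0 ≤ d i := fun i => by
    rw [hd]; exact (Matrix.posSemidef_conjTranspose_mul_self T).eigenvalues_nonneg i
  have h4 : mpow (Tᴴ * T) (α - 1) * (Tᴴ * T) =
      U * (Matrix.diagonal (fun i => ((d i ^ (α - 1) : ℝ) : ℂ)) * (Uᴴ * U) *
        Matrix.diagonal (fun i => (d i : ℂ))) * Uᴴ := by
    conv_lhs => rw [mpow, hAf]
    conv_lhs => enter [2]; rw [hAd]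
    simp only [Matrix.mul_assoc]
  rw [h4, hU, mul_one, Matrix.diagonal_mul_diagonal, mpow, hAf]
  congr 3
  ext i
  -- At a zero eigenvalue the value of `0 ^ (α - 1)` is irrelevant, being multiplied by `0`; the
  -- other side vanishes because `α > 0`.
  rcases (hd0 i).eq_or_lt with h5 | h5
  · simp [← h5, Real.zero_rpow hα.ne']
  · rw [← Complex.ofReal_mul, Real.rpow_sub_one h5.ne', div_mul_cancel₀ _ h5.ne']

end Powers

/-! ### The geometric mean with a positive definite first argument -/

section GeomMean

variable {n m : ℕ}

/-- Put `T = Rᴴ X^(-1/2)`: the inner matrix is `TᴴT`, while `TTᴴ = Rᴴ X⁻¹ R`. Moving the power to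
`TTᴴ` lets the outer factors `X^(±1/2)` cancel. -/
lemma geomMeanPos_eq {X : Matrix (Fin n) (Fin n) ℂ} (hX : X.PosDef)
    (R : Matrix (Fin n) (Fin m) ℂ) {α : ℝ} (hα : 0 < α) :
    geomMeanPos α X (R * Rᴴ) = R * mpow (Rᴴ * X⁻¹ * R) (α - 1) * Rᴴ := by
  have h0 : 0 ≤ X := Matrix.nonneg_iff_posSemidef.mpr hX.posSemidef
  have hT : mpow X (-(1 / 2)) * (R * Rᴴ) * mpow X (-(1 / 2)) =
      (Rᴴ * mpow X (-(1 / 2)))ᴴ * (Rᴴ * mpow X (-(1 / 2))) := by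
    rw [Matrix.conjTranspose_mul, Matrix.conjTranspose_conjTranspose, mpow_conjTranspose h0]
    simp only [Matrix.mul_assoc]
  have hT' : (Rᴴ * mpow X (-(1 / 2))) * (Rᴴ * mpow X (-(1 / 2)))ᴴ = Rᴴ * X⁻¹ * R := by
    rw [Matrix.conjTranspose_mul, Matrix.conjTranspose_conjTranspose, mpow_conjTranspose h0,
      ← mpow_neg_one hX, show (-1 : ℝ) = -(1 / 2) + -(1 / 2) by norm_num, mpow_add hX]
    simp only [Matrix.mul_assoc]
  rw [geomMeanPos, hT, mpow_conjTranspose_mul_self _ hα, hT', Matrix.conjTranspose_mul,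
    Matrix.conjTranspose_conjTranspose, mpow_conjTranspose h0]
  calc _ = (mpow X (1 / 2) * mpow X (-(1 / 2))) * R * mpow (Rᴴ * X⁻¹ * R) (α - 1) * Rᴴ *
        (mpow X (-(1 / 2)) * mpow X (1 / 2)) := by simp only [Matrix.mul_assoc]
    _ = _ := by rw [mpow_mul_neg hX, mpow_neg_mul hX, Matrix.one_mul, Matrix.mul_one]

lemma geomMeanPos_mono_right {X Y Z : Matrix (Fin n) (Fin n) ℂ} (hX : 0 ≤ X) (hY : 0 ≤ Y)
    (hYZ : Y ≤ Z) {α : ℝ} (hα : 0 ≤ α) (hα1 : α ≤ 1) :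
    geomMeanPos α X Y ≤ geomMeanPos α X Z := by
  have h1 : ∀ {A B C : Matrix (Fin n) (Fin n) ℂ}, 0 ≤ C → A ≤ B → ∀ p,
      mpow C p * A * mpow C p ≤ mpow C p * B * mpow C p := by
    intro A B C hC hAB p
    have := conj_le_conj hAB (mpow C p)
    rwa [mpow_conjTranspose hC] at this
  refine h1 hX (mpow_mono ?_ (h1 hX hYZ _) hα hα1) _
  simpa using h1 hX hY (-(1 / 2))

/-- The map `X ↦ (R* X⁻¹ R) ^ (α - 1)`, which computes the mean of `X` with `R R*`. -/
noncomputable def compressedMean (α : ℝ) (R : Matrix (Fin n) (Fin m) ℂ)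
    (X : Matrix (Fin n) (Fin n) ℂ) : Matrix (Fin m) (Fin m) ℂ :=
  mpow (Rᴴ * X⁻¹ * R) (α - 1)

lemma posDef_compression {X : Matrix (Fin n) (Fin n) ℂ} (hX : X.PosDef)
    {R : Matrix (Fin n) (Fin m) ℂ} (hR : Function.Injective R.mulVec) :
    (Rᴴ * X⁻¹ * R).PosDef := hX.inv.conjTranspose_mul_mul_same hR

/-- Inversion reverses the order, and the power `α - 1 ∈ [-1, 0]` reverses it again. -/
lemma compressedMean_mono {X Y : Matrix (Fin n) (Fin n) ℂ} (hX : X.PosDef) (hXY : X ≤ Y)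
    {R : Matrix (Fin n) (Fin m) ℂ} (hR : Function.Injective R.mulVec) {α : ℝ} (hα : 0 ≤ α)
    (hα1 : α ≤ 1) : compressedMean α R X ≤ compressedMean α R Y := by
  have := mpow_neg_anti (posDef_compression (posDef_of_le hX hXY) hR)
    (conj_le_conj (inv_anti hX hXY) R) (p := 1 - α) (by linarith) (by linarith)
  rwa [neg_sub] at this

lemma tendsto_inv {X : Type*} {l : Filter X} {F : X → Matrix (Fin n) (Fin n) ℂ}
    {A : Matrix (Fin n) (Fin n) ℂ} (hF : Filter.Tendsto F l (𝓝 A)) (hA : A.PosDef) :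
    Filter.Tendsto (fun x => (F x)⁻¹) l (𝓝 A⁻¹) := by
  have hd : A.det ≠ 0 := hA.det_pos.ne'
  have : ContinuousAt (Inv.inv : Matrix (Fin n) (Fin n) ℂ → _) A := by
    refine continuousAt_matrix_inv A ?_
    exact NormedRing.inverse_continuousAt (Units.mk0 _ hd)
  exact this.tendsto.comp hF

lemma tendsto_compressedMean {X : Type*} {l : Filter X} {F : X → Matrix (Fin n) (Fin n) ℂ}
    {A : Matrix (Fin n) (Fin n) ℂ} (hF : Filter.Tendsto F l (𝓝 A)) (hF0 : ∀ᶠ x in l, (F x).PosDef)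
    (hA : A.PosDef) {R : Matrix (Fin n) (Fin m) ℂ} (hR : Function.Injective R.mulVec) {α : ℝ}
    (hα1 : α ≤ 1) :
    Filter.Tendsto (fun x => compressedMean α R (F x)) l (𝓝 (compressedMean α R A)) := by
  -- Inverting the compression makes the exponent nonnegative, as `tendsto_mpow` requires.
  have key : ∀ {X : Matrix (Fin n) (Fin n) ℂ}, X.PosDef →
      compressedMean α R X = mpow (Rᴴ * X⁻¹ * R)⁻¹ (1 - α) := fun hX => by
    rw [mpow_inv (posDef_compression hX hR), neg_sub, compressedMean]
  rw [key hA]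
  refine Filter.Tendsto.congr' (hF0.mono fun x hx => (key hx).symm) ?_
  refine tendsto_mpow (tendsto_inv ?_ (posDef_compression hA hR)) ?_ ?_ (by linarith)
  · have h1 := tendsto_inv hF hA
    have hc : Continuous fun Y : Matrix (Fin n) (Fin n) ℂ => Rᴴ * Y * R := by fun_prop
    exact (hc.tendsto _).comp h1
  · exact hF0.mono fun x hx =>
      Matrix.nonneg_iff_posSemidef.mpr (posDef_compression hx hR).inv.posSemidef
  · exact Matrix.nonneg_iff_posSemidef.mpr (posDef_compression hA hR).inv.posSemidef

lemma compressedMean_nonneg {X : Matrix (Fin n) (Fin n) ℂ} (hX : X.PosDef)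
    (R : Matrix (Fin n) (Fin m) ℂ) (α : ℝ) : 0 ≤ compressedMean α R X :=
  mpow_nonneg (Matrix.nonneg_iff_posSemidef.mpr
    (hX.inv.posSemidef.conjTranspose_mul_mul_same R)) _

/-- Factoring `Y` through its square root reduces this to `compressedMean_mono`. -/
lemma geomMeanPos_mono_left {X X' Y : Matrix (Fin n) (Fin n) ℂ} (hX : X.PosDef) (hXX' : X ≤ X')
    (hY : Y.PosDef) {α : ℝ} (hα : 0 < α) (hα1 : α ≤ 1) :
    geomMeanPos α X Y ≤ geomMeanPos α X' Y := by
  have hY0 : 0 ≤ Y := Matrix.nonneg_iff_posSemidef.mpr hY.posSemidef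
  have hR : mpow Y (1 / 2) * (mpow Y (1 / 2))ᴴ = Y := by
    rw [mpow_conjTranspose hY0, ← mpow_add hY, add_halves, mpow_one hY0]
  have hinj : Function.Injective (mpow Y (1 / 2)).mulVec := by
    refine Matrix.mulVec_injective_of_isUnit ?_
    exact IsUnit.of_mul_eq_one _ (mpow_mul_neg hY _)
  rw [← hR, geomMeanPos_eq hX _ hα, geomMeanPos_eq (posDef_of_le hX hXX') _ hα]
  have := conj_le_conj (compressedMean_mono hX hXX' hinj hα.le hα1) (mpow Y (1 / 2))ᴴ
  rwa [Matrix.conjTranspose_conjTranspose] at this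

end GeomMean

/-! ### Limits of monotone matrix functions at singular matrices -/

section Limits

variable {n m : ℕ}

lemma posDef_add_smul_one {C : Matrix (Fin n) (Fin n) ℂ} (hC : 0 ≤ C) {ε : ℝ} (hε : 0 < ε) :
    (C + (ε : ℂ) • (1 : Matrix (Fin n) (Fin n) ℂ)).PosDef :=
  (Matrix.PosDef.one.smul (by exact_mod_cast hε : (0 : ℂ) < ε)).posSemidef_add
    (Matrix.nonneg_iff_posSemidef.mp hC)

lemma smul_one_le_smul_one {ε δ : ℝ} (h : ε ≤ δ) :
    (ε : ℂ) • (1 : Matrix (Fin n) (Fin n) ℂ) ≤ (δ : ℂ) • (1 : Matrix (Fin n) (Fin n) ℂ) := by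
  rw [Matrix.le_iff, ← sub_smul]
  exact Matrix.PosSemidef.one.smul (by exact_mod_cast sub_nonneg.mpr h)

lemma tendsto_add_smul_one (C : Matrix (Fin n) (Fin n) ℂ) :
    Filter.Tendsto (fun ε : ℝ => C + (ε : ℂ) • (1 : Matrix (Fin n) (Fin n) ℂ)) (𝓝[>] 0) (𝓝 C) := by
  have h : Continuous fun ε : ℝ => C + (ε : ℂ) • (1 : Matrix (Fin n) (Fin n) ℂ) := by fun_prop
  have := h.tendsto 0
  simp only [Complex.ofReal_zero, zero_smul, add_zero] at this
  exact this.mono_left nhdsWithin_le_nhds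

/-- A monotone continuous function on positive definite matrices has a limit at every positive
semidefinite matrix along the matrices above it, and that limit is a lower bound. -/
lemma exists_tendsto_of_monotone (F : Matrix (Fin n) (Fin n) ℂ → Matrix (Fin m) (Fin m) ℂ)
    (hmono : ∀ X Y, X.PosDef → X ≤ Y → F X ≤ F Y)
    (hcont : ∀ X : Matrix (Fin n) (Fin n) ℂ, X.PosDef → Filter.Tendsto F (𝓝[{Y | Y.PosDef}] X) (𝓝 (F X)))
    (hnonneg : ∀ X, X.PosDef → 0 ≤ F X) {C : Matrix (Fin n) (Fin n) ℂ} (hC : 0 ≤ C) :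
    ∃ L, 0 ≤ L ∧ (∀ X, X.PosDef → C ≤ X → L ≤ F X) ∧
      Filter.Tendsto F (𝓝[{X | X.PosDef ∧ C ≤ X}] C) (𝓝 L) := by
  set g : ℝ → Matrix (Fin m) (Fin m) ℂ := fun δ => F (C + (δ : ℂ) • 1) with hg
  have hpd : ∀ {δ : ℝ}, 0 < δ → (C + (δ : ℂ) • (1 : Matrix (Fin n) (Fin n) ℂ)).PosDef :=
    fun h => posDef_add_smul_one hC h
  have hgm : ∀ {ε δ : ℝ}, 0 < ε → ε ≤ δ → g ε ≤ g δ := fun h1 h2 =>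
    hmono _ _ (hpd h1) (add_le_add_right (smul_one_le_smul_one h2) C)
  have hlt : ∀ {δ : ℝ}, 0 < δ → ∀ᶠ ε in 𝓝[>] (0 : ℝ), 0 < ε ∧ ε ≤ δ := fun h => by
    filter_upwards [Ioc_mem_nhdsGT h] with ε hε using hε
  -- Monotonicity keeps `g` bounded near `0`, so compactness yields a cluster point `L`; it is then
  -- shown to be the limit.
  obtain ⟨L, -, hL⟩ := (isCompact_closedBall (0 : Matrix (Fin m) (Fin m) ℂ) ‖g 1‖).exists_mapClusterPt
    (f := 𝓝[>] (0 : ℝ)) (u := g) (by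
      rw [Filter.le_principal_iff, Filter.mem_map]
      filter_upwards [hlt one_pos] with ε hε
      rw [Set.mem_preimage, mem_closedBall_zero_iff]
      exact CStarAlgebra.norm_le_norm_of_nonneg_of_le (hnonneg _ (hpd hε.1)) (hgm hε.1 hε.2))
  have hLle : ∀ {δ : ℝ}, 0 < δ → L ≤ g δ := fun {δ} h => by
    by_contra hcon
    have := hL.frequently (isClosed_Iic.isOpen_compl.mem_nhds (show L ∈ (Set.Iic (g δ))ᶜ from hcon))
    obtain ⟨ε, h1, h2⟩ := (this.and_eventually (hlt h)).exists
    exact h1 (hgm h2.1 h2.2)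
  have hL0 : 0 ≤ L := by
    by_contra hcon
    have := hL.frequently (isClosed_Ici.isOpen_compl.mem_nhds
      (show L ∈ (Set.Ici (0 : Matrix (Fin m) (Fin m) ℂ))ᶜ from hcon))
    obtain ⟨ε, h1, h2⟩ := (this.and_eventually (hlt one_pos)).exists
    exact h1 (hnonneg _ (hpd h2.1))
  have hLF : ∀ X, X.PosDef → C ≤ X → L ≤ F X := by
    intro X hX hCX
    have hX0 : 0 ≤ X := hC.trans hCX
    have h1 : Filter.Tendsto (fun δ : ℝ => F (X + (δ : ℂ) • 1)) (𝓝[>] 0) (𝓝 (F X)) := by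
      refine (hcont X hX).comp (tendsto_nhdsWithin_iff.mpr ⟨tendsto_add_smul_one X, ?_⟩)
      filter_upwards [self_mem_nhdsWithin] with δ hδ using posDef_add_smul_one hX0 hδ
    refine ge_of_tendsto h1 ?_
    filter_upwards [self_mem_nhdsWithin] with δ hδ
    exact (hLle hδ).trans (hmono _ _ (hpd hδ) (by gcongr))
  refine ⟨L, hL0, hLF, ?_⟩
  rw [Metric.tendsto_nhds]
  intro η hη
  -- One `δ` with `g δ` near `L` suffices: each `X ≥ C` within `δ` of `C` satisfies `X ≤ C + δ`, so
  -- `L ≤ F X ≤ g δ`.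
  obtain ⟨δ, hδη, hδ, -⟩ := ((hL.frequently (Metric.ball_mem_nhds L hη)).and_eventually
    (hlt one_pos)).exists
  replace hδη : ‖g δ - L‖ < η := by rw [← dist_eq_norm]; exact hδη
  filter_upwards [self_mem_nhdsWithin, mem_nhdsWithin_of_mem_nhds (Metric.closedBall_mem_nhds C hδ)]
    with X hX hXC
  rw [Metric.mem_closedBall, dist_eq_norm] at hXC
  have hXle : X ≤ C + (δ : ℂ) • 1 := by
    have h1 : IsSelfAdjoint (X - C) := (sub_nonneg.mpr hX.2).isSelfAdjoint
    have h2 := h1.le_algebraMap_norm_self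
    rw [Algebra.algebraMap_eq_smul_one] at h2
    have h3 : (‖X - C‖ : ℝ) • (1 : Matrix (Fin n) (Fin n) ℂ) ≤ (δ : ℂ) • 1 :=
      smul_one_le_smul_one hXC
    exact sub_le_iff_le_add'.mp (h2.trans h3)
  rw [dist_eq_norm]
  refine lt_of_le_of_lt (CStarAlgebra.norm_le_norm_of_nonneg_of_le
    (sub_nonneg.mpr (hLF X hX.1 hX.2)) ?_) hδη
  exact sub_le_sub_right (hmono _ _ hX.1 hXle) L

lemma exists_tendsto_compressedMean {R : Matrix (Fin n) (Fin m) ℂ}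
    (hR : Function.Injective R.mulVec) {α : ℝ} (hα : 0 ≤ α) (hα1 : α ≤ 1)
    {C : Matrix (Fin n) (Fin n) ℂ} (hC : 0 ≤ C) :
    ∃ L, 0 ≤ L ∧ (∀ X, X.PosDef → C ≤ X → L ≤ compressedMean α R X) ∧
      Filter.Tendsto (compressedMean α R) (𝓝[{X | X.PosDef ∧ C ≤ X}] C) (𝓝 L) :=
  exists_tendsto_of_monotone _ (fun _ _ hX hXY => compressedMean_mono hX hXY hR hα hα1)
    (fun _ hX => tendsto_compressedMean
      ((continuous_id.tendsto _).mono_left nhdsWithin_le_nhds) self_mem_nhdsWithin hX hR hα1)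
    (fun _ hX => compressedMean_nonneg hX R α) hC

lemma tendsto_geomMeanPos_right (X : Matrix (Fin n) (Fin n) ℂ) (hX : 0 ≤ X) {ι : Type*}
    {l : Filter ι} {F : ι → Matrix (Fin n) (Fin n) ℂ} {Y : Matrix (Fin n) (Fin n) ℂ}
    (hF : Filter.Tendsto F l (𝓝 Y)) (hF0 : ∀ᶠ x in l, 0 ≤ F x) (hY : 0 ≤ Y) {α : ℝ}
    (hα : 0 ≤ α) :
    Filter.Tendsto (fun x => geomMeanPos α X (F x)) l (𝓝 (geomMeanPos α X Y)) := by
  have hc : ∀ P : Matrix (Fin n) (Fin n) ℂ,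
      Continuous fun Z : Matrix (Fin n) (Fin n) ℂ => P * Z * P := fun P => by fun_prop
  have h0 : ∀ {Z : Matrix (Fin n) (Fin n) ℂ}, 0 ≤ Z →
      0 ≤ mpow X (-(1 / 2)) * Z * mpow X (-(1 / 2)) := fun hZ => by
    have := conj_le_conj hZ (mpow X (-(1 / 2)))
    rw [mpow_conjTranspose hX] at this
    simpa using this
  exact ((hc (mpow X (1 / 2))).tendsto _).comp
    (tendsto_mpow (((hc (mpow X (-(1 / 2)))).tendsto _).comp hF) (hF0.mono fun _ h => h0 h)
      (h0 hY) hα)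

/-- The geometric mean of `C` with the projection `R R*` is obtained from the compressed mean. -/
lemma tendsto_geomMeanApprox {R : Matrix (Fin n) (Fin m) ℂ} {α : ℝ} (hα : 0 < α) (hα1 : α ≤ 1)
    {C : Matrix (Fin n) (Fin n) ℂ} (hC : 0 ≤ C) {L : Matrix (Fin m) (Fin m) ℂ}
    (hL : ∀ X, X.PosDef → C ≤ X → L ≤ compressedMean α R X)
    (hlim : Filter.Tendsto (compressedMean α R) (𝓝[{X | X.PosDef ∧ C ≤ X}] C) (𝓝 L)) :
    Filter.Tendsto (geomMeanApprox α C (R * Rᴴ)) (𝓝[>] 0) (𝓝 (R * L * Rᴴ)) := by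
  have hE : 0 ≤ R * Rᴴ := Matrix.nonneg_iff_posSemidef.mpr (Matrix.posSemidef_self_mul_conjTranspose R)
  have hCle : ∀ {δ : ℝ}, 0 < δ → C ≤ C + (δ : ℂ) • 1 := fun {δ} h => by
    have := smul_one_le_smul_one (n := n) h.le
    rw [Complex.ofReal_zero, zero_smul] at this
    exact le_add_of_nonneg_right this
  have hEle : ∀ {δ : ℝ}, 0 < δ → R * Rᴴ ≤ R * Rᴴ + (δ : ℂ) • 1 := fun {δ} h => by
    have := smul_one_le_smul_one (n := n) h.le
    rw [Complex.ofReal_zero, zero_smul] at this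
    exact le_add_of_nonneg_right this
  have hK : Filter.Tendsto (fun δ : ℝ => R * compressedMean α R (C + (δ : ℂ) • 1) * Rᴴ) (𝓝[>] 0)
      (𝓝 (R * L * Rᴴ)) := by
    have hc : Continuous fun Z : Matrix (Fin m) (Fin m) ℂ => R * Z * Rᴴ := by fun_prop
    refine (hc.tendsto L).comp (hlim.comp (tendsto_nhdsWithin_iff.mpr ⟨tendsto_add_smul_one C, ?_⟩))
    filter_upwards [self_mem_nhdsWithin] with δ hδ
    exact ⟨posDef_add_smul_one hC hδ, hCle hδ⟩
  rw [Metric.tendsto_nhds] at hK ⊢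
  intro η hη
  -- The two perturbations are decoupled. With `E = R Rᴴ` and `0 < ε ≤ δ`, the approximant lies
  -- between `R L Rᴴ` and the mean of `C + δ` with `E + ε`; for fixed `δ` the latter tends to the
  -- mean of `C + δ` with `E`, which is `η`-close to `R L Rᴴ`.
  obtain ⟨δ, hδη, hδ⟩ := ((hK η hη).and self_mem_nhdsWithin).exists
  replace hδ : 0 < δ := hδ
  have hXδ := posDef_add_smul_one hC hδ
  have hup := tendsto_geomMeanPos_right (C + (δ : ℂ) • 1)
    (Matrix.nonneg_iff_posSemidef.mpr hXδ.posSemidef) (tendsto_add_smul_one (R * Rᴴ))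
    (by filter_upwards [self_mem_nhdsWithin] with ε hε using hE.trans (hEle hε)) hE hα.le
  rw [geomMeanPos_eq hXδ R hα] at hup
  have hball : R * compressedMean α R (C + (δ : ℂ) • 1) * Rᴴ ∈ Metric.ball (R * L * Rᴴ) η := hδη
  filter_upwards [hup (Metric.isOpen_ball.mem_nhds hball), Ioc_mem_nhdsGT hδ] with ε h1 h2
  rw [Set.mem_preimage, Metric.mem_ball, dist_eq_norm] at h1
  rw [dist_eq_norm]
  have hXε := posDef_add_smul_one hC h2.1
  refine lt_of_le_of_lt (CStarAlgebra.norm_le_norm_of_nonneg_of_le (sub_nonneg.mpr ?_)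
    (sub_le_sub_right ?_ _)) h1
  · have h3 := conj_le_conj (hL _ hXε (hCle h2.1)) Rᴴ
    rw [Matrix.conjTranspose_conjTranspose] at h3
    refine h3.trans ?_
    have h4 := geomMeanPos_mono_right (Matrix.nonneg_iff_posSemidef.mpr hXε.posSemidef) hE
      (hEle h2.1) hα.le hα1
    rwa [geomMeanPos_eq hXε R hα] at h4
  · exact geomMeanPos_mono_left hXε (add_le_add_right (smul_one_le_smul_one h2.2) C)
      (posDef_add_smul_one hE h2.1) hα hα1

end Limits

/-! ### Eigenvalues in decreasing order -/

section Eig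

variable {n l : ℕ}

lemma eig_eq_eigenvalues₀ {X : Matrix (Fin n) (Fin n) ℂ} (hX : X.IsHermitian) {i : ℕ} (hi : i < n) :
    eig X i = hX.eigenvalues₀ ⟨i, by simpa using hi⟩ := by
  rw [eig, dif_pos ⟨hX, hi⟩]

lemma eig_antitone {X : Matrix (Fin n) (Fin n) ℂ} (hX : X.IsHermitian) :
    Antitone fun i : Fin n => eig X i := by
  intro i j hij
  simp only [eig_eq_eigenvalues₀ hX i.2, eig_eq_eigenvalues₀ hX j.2]
  exact hX.eigenvalues₀_antitone hij

/-- A decreasing list whose entries are the roots of the characteristic polynomial lists the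
eigenvalues. -/
lemma eig_eq_getElem {X : Matrix (Fin n) (Fin n) ℂ} (hX : X.IsHermitian) (L : List ℝ)
    (hL : L.Pairwise (· ≥ ·)) (hroots : X.charpoly.roots.map RCLike.re = (L : Multiset ℝ)) {i : ℕ}
    (hi : i < n) (hi' : i < L.length) : eig X i = L[i] := by
  have h1 := hX.sort_roots_charpoly_eq_eigenvalues₀
  rw [hroots, Multiset.coe_sort, List.mergeSort_of_pairwise (by simpa using hL)] at h1
  subst h1
  rw [eig_eq_eigenvalues₀ hX hi, List.getElem_ofFn]

lemma isHermitian_unitary_conj_diagonal (U : Matrix (Fin n) (Fin n) ℂ) (d : Fin n → ℝ) :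
    (U * Matrix.diagonal (fun i => (d i : ℂ)) * Uᴴ).IsHermitian := by
  refine Matrix.isHermitian_mul_mul_conjTranspose U (A := Matrix.diagonal (fun i => (d i : ℂ))) ?_
  rw [Matrix.isHermitian_diagonal_iff]
  intro i
  exact Complex.conj_ofReal _

lemma eig_unitary_conj_diagonal {U : Matrix (Fin n) (Fin n) ℂ} (hU : Uᴴ * U = 1) {d : Fin n → ℝ}
    (hd : Antitone d) (i : Fin n) :
    eig (U * Matrix.diagonal (fun i => (d i : ℂ)) * Uᴴ) i = d i := by
  have := eig_eq_getElem (isHermitian_unitary_conj_diagonal U d) (List.ofFn d)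
    (List.sortedGE_iff_pairwise.mp hd.sortedGE_ofFn) ?_ i.2 (by simp)
  · simpa using this
  · rw [Matrix.charpoly_mul_comm, ← Matrix.mul_assoc, hU, Matrix.one_mul, Matrix.charpoly_diagonal,
      Polynomial.roots_prod]
    · simp [List.ofFn_eq_map, Fin.univ_val_map, Function.comp_def]
    · simp [Finset.prod_ne_zero_iff, Polynomial.X_sub_C_ne_zero]

/-- Diagonalization of a Hermitian matrix with the eigenvalues in decreasing order. -/
lemma exists_unitary_eig {X : Matrix (Fin n) (Fin n) ℂ} (hX : X.IsHermitian) :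
    ∃ U : Matrix (Fin n) (Fin n) ℂ, Uᴴ * U = 1 ∧ U * Uᴴ = 1 ∧
      X = U * Matrix.diagonal (fun i : Fin n => (eig X i : ℂ)) * Uᴴ ∧
      ∀ f : ℝ → ℝ, cfc f X = U * Matrix.diagonal (fun i : Fin n => (f (eig X i) : ℂ)) * Uᴴ := by
  obtain ⟨U, d, hU, hU', hXd, hXf, hd⟩ := exists_unitary_cfc_eq hX
  -- `eigenvalues` is `eigenvalues₀` reindexed by an unspecified equivalence; `σ` undoes it.
  let σ : Fin n ≃ Fin n := (finCongr (Fintype.card_fin n).symm).trans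
    (Fintype.equivOfCardEq (Fintype.card_fin _))
  have hdσ : ∀ i, d (σ i) = eig X i := fun i => by
    rw [hd, Matrix.IsHermitian.eigenvalues, eig_eq_eigenvalues₀ hX i.2]
    simp [σ]; rfl
  have key : ∀ f : ℝ → ℝ, U * Matrix.diagonal (fun i => (f (d i) : ℂ)) * Uᴴ =
      U.submatrix id σ * Matrix.diagonal (fun i : Fin n => (f (eig X i) : ℂ)) *
        (U.submatrix id σ)ᴴ := fun f => by
    have h1 : Matrix.diagonal (fun i : Fin n => (f (eig X i) : ℂ)) =
        (Matrix.diagonal (fun i => (f (d i) : ℂ))).submatrix σ σ := by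
      rw [Matrix.submatrix_diagonal_equiv]
      congr 1
      ext i
      simp [hdσ]
    rw [h1, Matrix.conjTranspose_submatrix, Matrix.submatrix_mul_equiv, Matrix.submatrix_mul_equiv,
      Matrix.submatrix_id_id]
  refine ⟨U.submatrix id σ, ?_, ?_, ?_, fun f => (hXf f).trans (key f)⟩
  · rw [Matrix.conjTranspose_submatrix, ← Matrix.submatrix_mul _ _ _ _ _ Function.bijective_id, hU,
      Matrix.submatrix_one_equiv]
  · rw [Matrix.conjTranspose_submatrix, Matrix.submatrix_mul_equiv, hU', Matrix.submatrix_id_id]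
  · exact hXd.trans (key id)

lemma eig_nonneg {X : Matrix (Fin n) (Fin n) ℂ} (hX : 0 ≤ X) (i : ℕ) : 0 ≤ eig X i := by
  rw [eig]
  split_ifs with h
  · have := (Matrix.nonneg_iff_posSemidef.mp hX).eigenvalues_nonneg
      (Fintype.equivOfCardEq (Fintype.card_fin _) ⟨i, by simpa using h.2⟩)
    rw [Matrix.IsHermitian.eigenvalues, Equiv.symm_apply_apply] at this
    exact this
  · exact le_rfl

lemma eig_pos {X : Matrix (Fin n) (Fin n) ℂ} (hX : X.PosDef) {i : ℕ} (hi : i < n) :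
    0 < eig X i := by
  rw [eig_eq_eigenvalues₀ hX.1 hi]
  have := hX.eigenvalues_pos (Fintype.equivOfCardEq (Fintype.card_fin _) ⟨i, by simpa using hi⟩)
  rwa [Matrix.IsHermitian.eigenvalues, Equiv.symm_apply_apply] at this

/-- Dilating by an isometry only appends zero eigenvalues. -/
lemma eig_isometry_conj {V : Matrix (Fin n) (Fin l) ℂ} (hV : Vᴴ * V = 1)
    {K : Matrix (Fin l) (Fin l) ℂ} (hK : 0 ≤ K) (hln : l ≤ n) {i : ℕ} (hi : i < l) :
    eig (V * K * Vᴴ) i = eig K i := by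
  have hKh : K.IsHermitian := (Matrix.nonneg_iff_posSemidef.mp hK).1
  -- The characteristic polynomial is that of `VᴴVK = K` times `X^(n-l)`. Since `K ≥ 0`, the extra
  -- zeros come last.
  have h := eig_eq_getElem (X := V * K * Vᴴ) (Matrix.isHermitian_mul_mul_conjTranspose V hKh)
    (List.ofFn (fun i : Fin l => eig K i) ++ List.replicate (n - l) 0) ?_ ?_ (hi.trans_le hln)
    (by simp; omega)
  · rw [h, List.getElem_append_left (by simpa using hi), List.getElem_ofFn]
  · rw [List.pairwise_append]
    refine ⟨List.sortedGE_iff_pairwise.mp (eig_antitone hKh).sortedGE_ofFn, ?_, ?_⟩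
    · exact List.pairwise_replicate.mpr (Or.inr le_rfl)
    · intro a ha b hb
      obtain ⟨j, rfl⟩ := (List.mem_ofFn' _ _).mp ha
      rw [List.eq_of_mem_replicate hb]
      exact eig_nonneg hK _
  · rw [Matrix.charpoly_mul_comm_of_le _ _ (by simpa using hln), ← Matrix.mul_assoc, hV,
      Matrix.one_mul, Polynomial.roots_mul, Polynomial.roots_X_pow, Multiset.map_add]
    · obtain ⟨U, hU, -, hKd, -⟩ := exists_unitary_eig hKh
      conv_lhs => rw [hKd]
      rw [Matrix.charpoly_mul_comm, ← Matrix.mul_assoc, hU, Matrix.one_mul,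
        Matrix.charpoly_diagonal, Polynomial.roots_prod, add_comm, ← Multiset.coe_add]
      · congr 1
        · simp [List.ofFn_eq_map, Fin.univ_val_map, Function.comp_def]
        · simp [Multiset.nsmul_singleton, Multiset.coe_replicate]
      · simp [Finset.prod_ne_zero_iff, Polynomial.X_sub_C_ne_zero]
    · exact mul_ne_zero (pow_ne_zero _ Polynomial.X_ne_zero) (Matrix.charpoly_monic K).ne_zero

/-- A nonpositive power is decreasing on the positive axis, so it reverses the list of eigenvalues.
-/
lemma eig_mpow_neg {H : Matrix (Fin l) (Fin l) ℂ} (hH : H.PosDef) {s : ℝ} (hs : 0 ≤ s)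
    (i : Fin l) : eig (mpow H (-s)) i.rev = eig H i ^ (-s) := by
  obtain ⟨U, hU, hU', -, hHf⟩ := exists_unitary_eig hH.1
  have h1 : mpow H (-s) = U.submatrix id Fin.revPerm *
      Matrix.diagonal (fun i : Fin l => ((eig H i.rev ^ (-s) : ℝ) : ℂ)) *
        (U.submatrix id Fin.revPerm)ᴴ := by
    have h2 : Matrix.diagonal (fun i : Fin l => ((eig H i.rev ^ (-s) : ℝ) : ℂ)) =
        (Matrix.diagonal (fun i : Fin l => ((eig H i ^ (-s) : ℝ) : ℂ))).submatrix
          Fin.revPerm Fin.revPerm := by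
      rw [Matrix.submatrix_diagonal_equiv]; rfl
    rw [mpow, hHf, h2, Matrix.conjTranspose_submatrix, Matrix.submatrix_mul_equiv,
      Matrix.submatrix_mul_equiv, Matrix.submatrix_id_id]
  have h3 := eig_unitary_conj_diagonal (U := U.submatrix id Fin.revPerm) ?_
    (d := fun i : Fin l => eig H i.rev ^ (-s)) ?_ i.rev
  · rw [h1, h3, Fin.rev_rev]
  · rw [Matrix.conjTranspose_submatrix, ← Matrix.submatrix_mul _ _ _ _ _ Function.bijective_id, hU,
      Matrix.submatrix_one_equiv]
  · intro i j hij
    have h4 : eig H i.rev ≤ eig H j.rev := eig_antitone hH.1 (Fin.rev_le_rev.mpr hij)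
    exact Real.rpow_le_rpow_of_nonpos (eig_pos hH i.rev.2) h4 (by linarith)

end Eig

/-! ### Determinants of compressions -/

section CauchyBinet

/-- The Cauchy–Binet formula, summed over all maps instead of subsets. -/
lemma factorial_mul_det_mul {R : Type*} [CommRing R] {k n : ℕ} (A : Matrix (Fin k) (Fin n) R)
    (B : Matrix (Fin n) (Fin k) R) :
    (k.factorial : R) * (A * B).det =
      ∑ f : Fin k → Fin n, (A.submatrix id f).det * (B.submatrix f id).det := by
  have h1 : (A * B).det = ∑ f : Fin k → Fin n, (A.submatrix id f).det * ∏ i, B (f i) i := by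
    simp only [Matrix.det_apply', Matrix.mul_apply, Finset.prod_univ_sum, Finset.mul_sum,
      Finset.sum_mul, Fintype.piFinset_univ, Matrix.submatrix_apply, id]
    rw [Finset.sum_comm]
    refine Finset.sum_congr rfl fun f _ => Finset.sum_congr rfl fun σ _ => ?_
    rw [Finset.prod_mul_distrib, mul_assoc]
  -- Replacing `f` by `f ∘ τ` costs `sign τ`; summing over all `τ` completes the products of entries
  -- of `B` to a determinant.
  have h2 : ∀ τ : Equiv.Perm (Fin k), (A * B).det =
      ∑ f : Fin k → Fin n, (A.submatrix id f).det *
        ((Equiv.Perm.sign τ : ℤ) * ∏ i, B (f (τ i)) i) := fun τ => by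
    rw [h1, ← Equiv.sum_comp (Equiv.arrowCongr τ.symm (Equiv.refl (Fin n)))]
    refine Finset.sum_congr rfl fun f _ => ?_
    have h3 : (A.submatrix id (Equiv.arrowCongr τ.symm (Equiv.refl (Fin n)) f)).det =
        (Equiv.Perm.sign τ : ℤ) * (A.submatrix id f).det := by
      rw [← Matrix.det_permute']; rfl
    rw [h3]
    simp only [Equiv.arrowCongr_apply, Equiv.symm_symm, Equiv.coe_refl, Function.comp_apply, id]
    ring
  calc (k.factorial : R) * (A * B).det = ∑ _τ : Equiv.Perm (Fin k), (A * B).det := by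
        simp [Fintype.card_perm]
    _ = ∑ τ : Equiv.Perm (Fin k), ∑ f : Fin k → Fin n, (A.submatrix id f).det *
        ((Equiv.Perm.sign τ : ℤ) * ∏ i, B (f (τ i)) i) :=
        Finset.sum_congr rfl fun τ _ => h2 τ
    _ = _ := by
        rw [Finset.sum_comm]
        refine Finset.sum_congr rfl fun f _ => ?_
        rw [Matrix.det_apply' (B.submatrix f id), Finset.mul_sum]
        rfl

/-- The determinant of a compression of a diagonal matrix is a nonnegative combination of
products of diagonal entries. -/
lemma exists_weights_det {k n : ℕ} (W : Matrix (Fin n) (Fin k) ℂ) :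
    ∃ q : (Fin k → Fin n) → ℝ, (∀ f, 0 ≤ q f) ∧ (∀ f, ¬ Function.Injective f → q f = 0) ∧
      ∀ d : Fin n → ℝ, (Wᴴ * Matrix.diagonal (fun i => (d i : ℂ)) * W).det =
        ((∑ f, q f * ∏ i, d (f i) : ℝ) : ℂ) := by
  have hk : (k.factorial : ℂ) ≠ 0 := by exact_mod_cast k.factorial_ne_zero
  -- The weight is the squared modulus of a maximal minor of `W`, divided by `k!` since each row set
  -- occurs in `k!` orders.
  refine ⟨fun f => Complex.normSq (W.submatrix f id).det / k.factorial, fun f => by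
    have := Complex.normSq_nonneg (W.submatrix f id).det
    positivity, fun f hf => ?_, fun d => ?_⟩
  · have : (W.submatrix f id).det = 0 := by
      obtain ⟨i, j, hij, hne⟩ := Function.not_injective_iff.mp hf
      exact Matrix.det_zero_of_row_eq hne (by ext a; simp [hij])
    simp [this]
  · have h := factorial_mul_det_mul (Wᴴ * Matrix.diagonal (fun i => (d i : ℂ))) W
    rw [← mul_right_inj' hk, h]
    push_cast
    rw [Finset.mul_sum]
    refine Finset.sum_congr rfl fun f _ => ?_
    have h1 : (Wᴴ * Matrix.diagonal (fun i => (d i : ℂ))).submatrix id f =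
        (W.submatrix f id)ᴴ * Matrix.diagonal (fun i => (d (f i) : ℂ)) := by
      ext i j
      simp [Matrix.mul_diagonal]
    rw [h1, Matrix.det_mul, Matrix.det_conjTranspose, Matrix.det_diagonal,
      ← Complex.mul_conj (W.submatrix f id).det]
    field_simp
    rw [Complex.star_def]
    ring

variable {k l : ℕ}

lemma castLE_le_of_strictMono {e : Fin k → Fin l} (he : StrictMono e) (i : Fin k) :
    (i : ℕ) ≤ e i := by
  obtain ⟨i, hi⟩ := i
  induction i with
  | zero => simp
  | succ j ih =>
    have h1 := ih (by omega)
    have h2 : e ⟨j, by omega⟩ < e ⟨j + 1, hi⟩ := he (by simp)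
    have h3 : (e ⟨j, by omega⟩ : ℕ) < e ⟨j + 1, hi⟩ := h2
    simp only at h1 ⊢
    omega

lemma exists_strictMono_prod_eq {f : Fin k → Fin l} (hf : Function.Injective f) :
    ∃ e : Fin k → Fin l, StrictMono e ∧ ∀ d : Fin l → ℝ, ∏ i, d (f i) = ∏ i, d (e i) := by
  have hc : (Finset.univ.image f).card = k := by
    rw [Finset.card_image_of_injective _ hf, Finset.card_univ, Fintype.card_fin]
  refine ⟨(Finset.univ.image f).orderEmbOfFin hc, OrderEmbedding.strictMono _, fun d => ?_⟩
  have h1 : ∏ i, d (f i) = ∏ x ∈ Finset.univ.image f, d x := by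
    rw [Finset.prod_image fun a _ b _ h => hf h]
  have h2 : ∏ i, d ((Finset.univ.image f).orderEmbOfFin hc i) =
      ∏ x ∈ Finset.univ.image ((Finset.univ.image f).orderEmbOfFin hc), d x := by
    rw [Finset.prod_image fun a _ b _ h => ((Finset.univ.image f).orderEmbOfFin hc).injective h]
  rw [h1, h2, Finset.image_orderEmbOfFin_univ]

/-- Once the values of `f` are sorted, the `i`-th is at least `i`, so the factors compare one by
one. -/
lemma prod_le_prod_castLE {d : Fin l → ℝ} (hd : Antitone d) (hd0 : ∀ i, 0 ≤ d i) (hkl : k ≤ l)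
    {f : Fin k → Fin l} (hf : Function.Injective f) :
    ∏ i, d (f i) ≤ ∏ i : Fin k, d (Fin.castLE hkl i) := by
  obtain ⟨e, he, hfe⟩ := exists_strictMono_prod_eq hf
  rw [hfe]
  exact Finset.prod_le_prod (fun i _ => hd0 _) fun i _ => hd (castLE_le_of_strictMono he i)

lemma prod_castLE_le_prod {d : Fin l → ℝ} (hd : Monotone d) (hd0 : ∀ i, 0 ≤ d i) (hkl : k ≤ l)
    {f : Fin k → Fin l} (hf : Function.Injective f) :
    ∏ i : Fin k, d (Fin.castLE hkl i) ≤ ∏ i, d (f i) := by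
  obtain ⟨e, he, hfe⟩ := exists_strictMono_prod_eq hf
  rw [hfe]
  exact Finset.prod_le_prod (fun i _ => hd0 _) fun i _ => hd (castLE_le_of_strictMono he i)

/-- The determinant of a compression of a positive semidefinite matrix to `k` dimensions lies
between the products of its `k` smallest and its `k` largest eigenvalues. -/
lemma prod_eig_le_det_and_det_le_prod_eig {K : Matrix (Fin l) (Fin l) ℂ} (hK : 0 ≤ K)
    (hkl : k ≤ l) {Z : Matrix (Fin l) (Fin k) ℂ} (hZ : Zᴴ * Z = 1) :
    ∏ i : Fin k, eig K (Fin.castLE hkl i).rev ≤ (Zᴴ * K * Z).det.re ∧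
      (Zᴴ * K * Z).det.re ≤ ∏ i : Fin k, eig K (Fin.castLE hkl i) := by
  have hKh : K.IsHermitian := (Matrix.nonneg_iff_posSemidef.mp hK).1
  obtain ⟨U, -, hU', hKd, -⟩ := exists_unitary_eig hKh
  obtain ⟨q, hq0, hqi, hq⟩ := exists_weights_det (Uᴴ * Z)
  -- Taking all diagonal entries equal to `1` shows that the determinant is a convex combination of
  -- `k`-fold products of eigenvalues.
  have h1 : ∑ f, q f = 1 := by
    have h2 := hq fun _ => 1
    simp only [Complex.ofReal_one, Matrix.diagonal_one, Matrix.mul_one, Finset.prod_const_one,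
      mul_one] at h2
    rw [Matrix.conjTranspose_mul, Matrix.conjTranspose_conjTranspose, Matrix.mul_assoc,
      ← Matrix.mul_assoc U, hU', Matrix.one_mul, hZ, Matrix.det_one] at h2
    exact_mod_cast h2.symm
  have h3 : (Zᴴ * K * Z).det.re = ∑ f, q f * ∏ i, eig K (f i) := by
    have h4 := hq fun i => eig K i
    rw [Matrix.conjTranspose_mul, Matrix.conjTranspose_conjTranspose] at h4
    have h5 : Zᴴ * K * Z =
        Zᴴ * U * Matrix.diagonal (fun i : Fin l => (eig K i : ℂ)) * (Uᴴ * Z) := by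
      conv_lhs => rw [hKd]
      simp only [Matrix.mul_assoc]
    rw [h5, h4, Complex.ofReal_re]
  rw [h3]
  constructor
  · calc ∏ i : Fin k, eig K (Fin.castLE hkl i).rev
        = ∑ f, q f * ∏ i : Fin k, eig K (Fin.castLE hkl i).rev := by
          rw [← Finset.sum_mul, h1, one_mul]
      _ ≤ _ := Finset.sum_le_sum fun f _ => ?_
    by_cases hf : Function.Injective f
    · refine mul_le_mul_of_nonneg_left ?_ (hq0 f)
      have := prod_castLE_le_prod (d := fun i : Fin l => eig K i.rev)
        (fun i j hij => eig_antitone hKh (Fin.rev_le_rev.mpr hij)) (fun i => eig_nonneg hK _) hkl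
        (Fin.rev_injective.comp hf)
      simpa using this
    · simp [hqi f hf]
  · calc _ ≤ ∑ f, q f * ∏ i : Fin k, eig K (Fin.castLE hkl i) :=
          Finset.sum_le_sum fun f _ => ?_
      _ = _ := by rw [← Finset.sum_mul, h1, one_mul]
    by_cases hf : Function.Injective f
    · exact mul_le_mul_of_nonneg_left
        (prod_le_prod_castLE (eig_antitone hKh) (fun i => eig_nonneg hK _) hkl hf) (hq0 f)
    · simp [hqi f hf]

/-- Any `k` eigenvalues are realised by a compression. -/
lemma exists_isometry_det_eq {K : Matrix (Fin l) (Fin l) ℂ} (hK : K.IsHermitian)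
    {f : Fin k → Fin l} (hf : Function.Injective f) :
    ∃ Z : Matrix (Fin l) (Fin k) ℂ, Zᴴ * Z = 1 ∧ (Zᴴ * K * Z).det.re = ∏ i, eig K (f i) := by
  obtain ⟨U, hU, -, hKd, -⟩ := exists_unitary_eig hK
  refine ⟨U.submatrix id f, ?_, ?_⟩
  · rw [Matrix.conjTranspose_submatrix, ← Matrix.submatrix_mul _ _ _ _ _ Function.bijective_id, hU,
      Matrix.submatrix_one _ hf]
  · have h1 : (U.submatrix id f)ᴴ * K * U.submatrix id f =
        Matrix.diagonal (fun i => (eig K (f i) : ℂ)) := by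
      have h2 : Uᴴ * K * U = Matrix.diagonal (fun i : Fin l => (eig K i : ℂ)) := by
        conv_lhs => rw [hKd]
        calc _ = (Uᴴ * U) * Matrix.diagonal (fun i : Fin l => (eig K i : ℂ)) * (Uᴴ * U) := by
              simp only [Matrix.mul_assoc]
          _ = _ := by rw [hU, Matrix.one_mul, Matrix.mul_one]
      have h3 : (U.submatrix id f)ᴴ * K * U.submatrix id f = (Uᴴ * K * U).submatrix f f := by
        rw [Matrix.submatrix_mul _ _ _ _ _ Function.bijective_id,
          Matrix.submatrix_mul _ _ _ _ _ Function.bijective_id, Matrix.submatrix_id_id,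
          Matrix.conjTranspose_submatrix]
      rw [h3, h2, Matrix.submatrix_diagonal _ _ hf]
      rfl
    rw [h1, Matrix.det_diagonal, ← Complex.ofReal_prod, Complex.ofReal_re]

/-- The determinant is monotone on positive semidefinite matrices. -/
lemma det_re_mono {M N : Matrix (Fin k) (Fin k) ℂ} (hM : 0 ≤ M) (hMN : M ≤ N) :
    M.det.re ≤ N.det.re := by
  have hM' := Matrix.nonneg_iff_posSemidef.mp hM
  have hN' := Matrix.nonneg_iff_posSemidef.mp (hM.trans hMN)
  have hN0 : 0 ≤ N.det.re := (Complex.nonneg_iff.mp hN'.det_nonneg).1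
  by_cases h0 : M.det = 0
  · simpa [h0] using hN0
  have hMp : M.PosDef := hM'.posDef_iff_det_ne_zero.mpr h0
  set S := mpow M (1 / 2) with hS
  set T := mpow M (-(1 / 2)) with hT
  have hST : S * T = 1 := mpow_mul_neg hMp _
  have hTS : T * S = 1 := mpow_neg_mul hMp _
  have hSS : S * S = M := by rw [hS, ← mpow_add hMp, add_halves, mpow_one hM]
  have hP : (T * (N - M) * T).PosSemidef := by
    have := (Matrix.le_iff.mp hMN).conjTranspose_mul_mul_same T
    rwa [mpow_conjTranspose hM] at this
  -- Hence `det N = det M * det (1 + P)` with `P = T (N - M) T ≥ 0`, and the last factor is at least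
  -- `1`.
  have hN : N = S * (1 + T * (N - M) * T) * S := by
    have : S * (1 + T * (N - M) * T) * S = S * S + (S * T) * (N - M) * (T * S) := by
      noncomm_ring
    rw [this, hST, hTS, hSS]
    simp
  obtain ⟨U, hU, hU', hPd, -⟩ := exists_unitary_eig hP.1
  have h1 : (1 + T * (N - M) * T).det =
      ((∏ i : Fin k, (1 + eig (T * (N - M) * T) i) : ℝ) : ℂ) := by
    have h2 : 1 + T * (N - M) * T = U * Matrix.diagonal
        (fun i : Fin k => ((1 + eig (T * (N - M) * T) i : ℝ) : ℂ)) * Uᴴ := by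
      have h3 : Matrix.diagonal (fun i : Fin k => ((1 + eig (T * (N - M) * T) i : ℝ) : ℂ)) =
          1 + Matrix.diagonal (fun i : Fin k => (eig (T * (N - M) * T) i : ℂ)) := by
        rw [← Matrix.diagonal_one, Matrix.diagonal_add]
        simp
      rw [h3, Matrix.mul_add, Matrix.add_mul, Matrix.mul_one, hU', ← hPd]
    rw [h2, Matrix.det_mul, Matrix.det_mul, mul_comm, ← mul_assoc, ← Matrix.det_mul, hU,
      Matrix.det_one, one_mul, Matrix.det_diagonal, ← Complex.ofReal_prod]
  have h4 : N.det = M.det * ((∏ i : Fin k, (1 + eig (T * (N - M) * T) i) : ℝ) : ℂ) := by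
    conv_lhs => rw [hN, Matrix.det_mul, Matrix.det_mul, h1]
    rw [← hSS, Matrix.det_mul]
    ring
  rw [h4, Complex.re_mul_ofReal]
  refine le_mul_of_one_le_right (Complex.nonneg_iff.mp hM'.det_nonneg).1 ?_
  calc (1 : ℝ) = ∏ _i : Fin k, (1 : ℝ) := by simp
    _ ≤ _ := Finset.prod_le_prod (fun _ _ => zero_le_one) fun i _ => by
      have := eig_nonneg (Matrix.nonneg_iff_posSemidef.mpr hP) i
      linarith

/-- Compress to the bottom `k` eigenvectors of the larger matrix `K'`: its determinant there is the
right-hand side, and it dominates the determinant of the compressed `K`. -/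
lemma prod_eig_mono {K K' : Matrix (Fin l) (Fin l) ℂ} (hK : 0 ≤ K) (hKK' : K ≤ K') (hkl : k ≤ l) :
    ∏ i : Fin k, eig K (Fin.castLE hkl i).rev ≤ ∏ i : Fin k, eig K' (Fin.castLE hkl i).rev := by
  obtain ⟨Z, hZ, hZd⟩ := exists_isometry_det_eq
    (Matrix.nonneg_iff_posSemidef.mp (hK.trans hKK')).1
    (f := fun i : Fin k => (Fin.castLE hkl i).rev)
    (Fin.rev_injective.comp (Fin.castLE_injective hkl))
  rw [← hZd]
  refine ((prod_eig_le_det_and_det_le_prod_eig hK hkl hZ).1).trans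
    (det_re_mono ?_ (conj_le_conj hKK' Z))
  simpa using conj_le_conj hK Z

end CauchyBinet

/-! ### Logarithmic convexity of compressed powers -/

section Interpolation

variable {n l k : ℕ}

/-- Hölder's inequality: `s ↦ ∑ q b ^ s` is logarithmically convex. -/
lemma sum_mul_rpow_le {ι : Type*} (S : Finset ι) {q b : ι → ℝ} (hq : ∀ i, 0 ≤ q i)
    (hb : ∀ i, 0 < b i) (s t : ℝ) {θ : ℝ} (hθ0 : 0 ≤ θ) (hθ1 : θ ≤ 1) :
    ∑ i ∈ S, q i * b i ^ ((1 - θ) * s + θ * t) ≤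
      (∑ i ∈ S, q i * b i ^ s) ^ (1 - θ) * (∑ i ∈ S, q i * b i ^ t) ^ θ := by
  have hnn : ∀ r : ℝ, 0 ≤ ∑ i ∈ S, q i * b i ^ r := fun r =>
    Finset.sum_nonneg fun i _ => mul_nonneg (hq i) (Real.rpow_nonneg (hb i).le _)
  by_cases hpos : ∃ i ∈ S, 0 < q i
  swap
  · have h0 : ∀ i ∈ S, q i = 0 := fun i hi =>
      le_antisymm (not_lt.mp fun h => hpos ⟨i, hi, h⟩) (hq i)
    rw [Finset.sum_eq_zero fun i hi => by rw [h0 i hi, zero_mul]]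
    exact mul_nonneg (Real.rpow_nonneg (hnn s) _) (Real.rpow_nonneg (hnn t) _)
  obtain ⟨j, hj, hqj⟩ := hpos
  have hp : ∀ r : ℝ, 0 < ∑ i ∈ S, q i * b i ^ r := fun r =>
    Finset.sum_pos' (fun i _ => mul_nonneg (hq i) (Real.rpow_nonneg (hb i).le _))
      ⟨j, hj, mul_pos hqj (Real.rpow_pos_of_pos (hb j) _)⟩
  set P := ∑ i ∈ S, q i * b i ^ s with hP
  set Q := ∑ i ∈ S, q i * b i ^ t with hQ
  have hP0 : 0 < P := hp s
  have hQ0 : 0 < Q := hp t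
  have hPQ : 0 < P ^ (1 - θ) * Q ^ θ :=
    mul_pos (Real.rpow_pos_of_pos hP0 _) (Real.rpow_pos_of_pos hQ0 _)
  -- Weighted AM–GM on terms normalised by `P` and `Q`; after summation the bracket becomes `(1 - θ)
  -- + θ = 1`.
  have hterm : ∀ i ∈ S, q i * b i ^ ((1 - θ) * s + θ * t) ≤
      (P ^ (1 - θ) * Q ^ θ) * ((1 - θ) * (q i * b i ^ s / P) + θ * (q i * b i ^ t / Q)) := by
    intro i _
    have h1 := Real.geom_mean_le_arith_mean2_weighted (sub_nonneg.mpr hθ1) hθ0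
      (div_nonneg (Real.rpow_nonneg (hb i).le s) hP0.le)
      (div_nonneg (Real.rpow_nonneg (hb i).le t) hQ0.le) (by ring)
    rw [Real.div_rpow (Real.rpow_nonneg (hb i).le s) hP0.le,
      Real.div_rpow (Real.rpow_nonneg (hb i).le t) hQ0.le, ← Real.rpow_mul (hb i).le,
      ← Real.rpow_mul (hb i).le, div_mul_div_comm, ← Real.rpow_add (hb i), div_le_iff₀ hPQ,
      mul_comm s, mul_comm t] at h1
    calc _ ≤ q i * (((1 - θ) * (b i ^ s / P) + θ * (b i ^ t / Q)) * (P ^ (1 - θ) * Q ^ θ)) :=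
          mul_le_mul_of_nonneg_left h1 (hq i)
      _ = _ := by ring
  refine (Finset.sum_le_sum hterm).trans_eq ?_
  rw [← Finset.mul_sum, Finset.sum_add_distrib, ← Finset.mul_sum, ← Finset.mul_sum,
    ← Finset.sum_div, ← Finset.sum_div, ← hP, ← hQ, div_self hP0.ne', div_self hQ0.ne']
  ring

lemma mulVec_injective_of_isometry {V : Matrix (Fin n) (Fin l) ℂ} (hV : Vᴴ * V = 1) :
    Function.Injective V.mulVec := by
  intro x y hxy
  have h := congrArg (Vᴴ).mulVec hxy
  simpa [Matrix.mulVec_mulVec, hV] using h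

lemma posDef_unitary_conj_diagonal {U : Matrix (Fin n) (Fin n) ℂ} (hU' : U * Uᴴ = 1)
    {a : Fin n → ℝ} (ha : ∀ i, 0 < a i) :
    (U * Matrix.diagonal (fun i => (a i : ℂ)) * Uᴴ).PosDef := by
  have h1 : (Matrix.diagonal (fun i => (a i : ℂ))).PosDef :=
    Matrix.PosDef.diagonal fun i => by exact_mod_cast ha i
  have h2 := h1.conjTranspose_mul_mul_same (B := Uᴴ)
    (mulVec_injective_of_isometry (by rwa [Matrix.conjTranspose_conjTranspose]))
  rwa [Matrix.conjTranspose_conjTranspose] at h2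

lemma inv_unitary_conj_diagonal {U : Matrix (Fin n) (Fin n) ℂ} (hU : Uᴴ * U = 1)
    (hU' : U * Uᴴ = 1) {a : Fin n → ℝ} (ha : ∀ i, 0 < a i) :
    (U * Matrix.diagonal (fun i => (a i : ℂ)) * Uᴴ)⁻¹ =
      U * Matrix.diagonal (fun i => (((a i)⁻¹ : ℝ) : ℂ)) * Uᴴ := by
  refine Matrix.inv_eq_left_inv ?_
  calc _ = U * (Matrix.diagonal (fun i => (((a i)⁻¹ : ℝ) : ℂ)) * (Uᴴ * U) *
        Matrix.diagonal (fun i => (a i : ℂ))) * Uᴴ := by simp only [Matrix.mul_assoc]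
    _ = _ := by
      rw [hU, Matrix.mul_one, Matrix.diagonal_mul_diagonal]
      have : (fun i => (((a i)⁻¹ : ℝ) : ℂ) * (a i : ℂ)) = fun _ => 1 := by
        ext i
        rw [← Complex.ofReal_mul, inv_mul_cancel₀ (ha i).ne', Complex.ofReal_one]
      rw [this, Matrix.diagonal_one, Matrix.mul_one, hU']

/-- The products of the largest eigenvalues of the compressions of `D ^ s` are logarithmically
convex in `s`. -/
lemma prod_eig_compression_le {U : Matrix (Fin n) (Fin n) ℂ} (hU' : U * Uᴴ = 1) {b : Fin n → ℝ}
    (hb : ∀ i, 0 < b i) {V : Matrix (Fin n) (Fin l) ℂ} (hkl : k ≤ l) {H : ℝ → Matrix (Fin l) (Fin l) ℂ}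
    (hH : ∀ s, H s = Vᴴ * (U * Matrix.diagonal (fun i => ((b i ^ s : ℝ) : ℂ)) * Uᴴ) * V)
    (s t : ℝ) {θ : ℝ} (hθ0 : 0 ≤ θ) (hθ1 : θ ≤ 1) :
    ∏ i : Fin k, eig (H ((1 - θ) * s + θ * t)) (Fin.castLE hkl i) ≤
      (∏ i : Fin k, eig (H s) (Fin.castLE hkl i)) ^ (1 - θ) *
        (∏ i : Fin k, eig (H t) (Fin.castLE hkl i)) ^ θ := by
  have hH0 : ∀ s, 0 ≤ H s := fun s => by
    rw [hH]
    exact Matrix.nonneg_iff_posSemidef.mpr ((posDef_unitary_conj_diagonal hU'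
      fun i => Real.rpow_pos_of_pos (hb i) s).posSemidef.conjTranspose_mul_mul_same V)
  -- `Z` attains the top product at the interpolated exponent; at `s` and `t` the same `Z` gives
  -- only a lower bound, which is the direction needed.
  obtain ⟨Z, hZ, hZd⟩ := exists_isometry_det_eq
    (Matrix.nonneg_iff_posSemidef.mp (hH0 ((1 - θ) * s + θ * t))).1 (Fin.castLE_injective hkl)
  obtain ⟨q, hq0, -, hq⟩ := exists_weights_det (Uᴴ * V * Z)
  have hdet : ∀ s, (Zᴴ * H s * Z).det.re = ∑ f, q f * (∏ i, b (f i)) ^ s := fun s => by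
    have h1 : Zᴴ * H s * Z = (Uᴴ * V * Z)ᴴ *
        Matrix.diagonal (fun i => ((b i ^ s : ℝ) : ℂ)) * (Uᴴ * V * Z) := by
      rw [hH]
      simp only [Matrix.conjTranspose_mul, Matrix.conjTranspose_conjTranspose, Matrix.mul_assoc]
    rw [h1, hq fun i => b i ^ s, Complex.ofReal_re]
    refine Finset.sum_congr rfl fun f _ => ?_
    rw [Real.finsetProd_rpow _ _ fun i _ => (hb _).le]
  have hle : ∀ s, 0 ≤ (Zᴴ * H s * Z).det.re ∧
      (Zᴴ * H s * Z).det.re ≤ ∏ i : Fin k, eig (H s) (Fin.castLE hkl i) := fun s =>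
    ⟨(Complex.nonneg_iff.mp ((Matrix.nonneg_iff_posSemidef.mp
      (hH0 s)).conjTranspose_mul_mul_same Z).det_nonneg).1,
      (prod_eig_le_det_and_det_le_prod_eig (hH0 s) hkl hZ).2⟩
  rw [← hZd, hdet]
  refine (sum_mul_rpow_le _ hq0 (fun f => Finset.prod_pos fun i _ => hb _) s t hθ0 hθ1).trans ?_
  rw [← hdet, ← hdet]
  have h1θ : 0 ≤ 1 - θ := by linarith
  exact mul_le_mul (Real.rpow_le_rpow (hle s).1 (hle s).2 h1θ)
    (Real.rpow_le_rpow (hle t).1 (hle t).2 hθ0) (Real.rpow_nonneg (hle t).1 _)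
    (Real.rpow_nonneg ((hle s).1.trans (hle s).2) _)

/-- The products of the smallest eigenvalues of the compressed means of `D ^ p` are
logarithmically concave in `p`. -/
lemma prod_eig_compressedMean_ge {U : Matrix (Fin n) (Fin n) ℂ} (hU : Uᴴ * U = 1)
    (hU' : U * Uᴴ = 1) {a : Fin n → ℝ} (ha : ∀ i, 0 < a i) {V : Matrix (Fin n) (Fin l) ℂ}
    (hV : Vᴴ * V = 1) {α : ℝ} (hα1 : α ≤ 1) (hkl : k ≤ l) {K : ℝ → Matrix (Fin l) (Fin l) ℂ}
    (hK : ∀ p, K p = compressedMean α V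
      (U * Matrix.diagonal (fun i => ((a i ^ p : ℝ) : ℂ)) * Uᴴ))
    (s t : ℝ) {θ : ℝ} (hθ0 : 0 ≤ θ) (hθ1 : θ ≤ 1) :
    (∏ i : Fin k, eig (K s) (Fin.castLE hkl i).rev) ^ (1 - θ) *
        (∏ i : Fin k, eig (K t) (Fin.castLE hkl i).rev) ^ θ ≤
      ∏ i : Fin k, eig (K ((1 - θ) * s + θ * t)) (Fin.castLE hkl i).rev := by
  set H : ℝ → Matrix (Fin l) (Fin l) ℂ := fun s =>
    Vᴴ * (U * Matrix.diagonal (fun i => (((a i)⁻¹ ^ s : ℝ) : ℂ)) * Uᴴ) * V with hH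
  have hpos : ∀ p, (H p).PosDef := fun p =>
    (posDef_unitary_conj_diagonal hU' fun i =>
      Real.rpow_pos_of_pos (inv_pos.mpr (ha i)) p).conjTranspose_mul_mul_same
        (mulVec_injective_of_isometry hV)
  have hKH : ∀ p, K p = mpow (H p) (-(1 - α)) := fun p => by
    rw [hK, compressedMean, inv_unitary_conj_diagonal hU hU' fun i => Real.rpow_pos_of_pos (ha i) p,
      neg_sub]
    simp only [hH, Real.inv_rpow (ha _).le]
  have hbot : ∀ p, ∏ i : Fin k, eig (K p) (Fin.castLE hkl i).rev =
      (∏ i : Fin k, eig (H p) (Fin.castLE hkl i)) ^ (-(1 - α)) := fun p => by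
    rw [← Real.finsetProd_rpow _ _ fun i _ => (eig_pos (hpos p) (Fin.castLE hkl i).2).le]
    refine Finset.prod_congr rfl fun i _ => ?_
    rw [hKH, eig_mpow_neg (hpos p) (by linarith)]
  have htop : ∀ p, 0 < ∏ i : Fin k, eig (H p) (Fin.castLE hkl i) := fun p =>
    Finset.prod_pos fun i _ => eig_pos (hpos p) (Fin.castLE hkl i).2
  rw [hbot, hbot, hbot, ← Real.rpow_mul (htop s).le, ← Real.rpow_mul (htop t).le,
    mul_comm _ (1 - θ), mul_comm _ θ, Real.rpow_mul (htop s).le, Real.rpow_mul (htop t).le,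
    ← Real.mul_rpow (Real.rpow_nonneg (htop s).le _) (Real.rpow_nonneg (htop t).le _)]
  exact Real.rpow_le_rpow_of_nonpos (htop _)
    (prod_eig_compression_le hU' (fun i => inv_pos.mpr (ha i)) hkl (fun _ => rfl) s t hθ0 hθ1)
    (by linarith)

end Interpolation

/-! ### Projections -/

section Projection

variable {n l : ℕ}

lemma exists_isometry_of_isStarProjection {E : Matrix (Fin n) (Fin n) ℂ} (hE : IsStarProjection E)
    (hl : E.rank = l) : ∃ V : Matrix (Fin n) (Fin l) ℂ, Vᴴ * V = 1 ∧ V * Vᴴ = E := by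
  have hEh : E.IsHermitian := hE.isSelfAdjoint
  obtain ⟨U, d, hU, hU', hEd, -, hd⟩ := exists_unitary_cfc_eq hEh
  have hdiag : Matrix.diagonal (fun i => (d i : ℂ)) = Uᴴ * E * U := by
    conv_rhs => rw [hEd]
    calc _ = (Uᴴ * U) * Matrix.diagonal (fun i => (d i : ℂ)) * (Uᴴ * U) := by
          rw [hU, Matrix.one_mul, Matrix.mul_one]
      _ = _ := by simp only [Matrix.mul_assoc]
  have hd1 : ∀ i, d i ≠ 0 → d i = 1 := fun i hi => by
    have h1 : Matrix.diagonal (fun i => (d i : ℂ)) * Matrix.diagonal (fun i => (d i : ℂ)) =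
        Matrix.diagonal (fun i => (d i : ℂ)) := by
      rw [hdiag]
      calc _ = Uᴴ * E * (U * Uᴴ) * E * U := by simp only [Matrix.mul_assoc]
        _ = Uᴴ * (E * E) * U := by rw [hU', Matrix.mul_one]; simp only [Matrix.mul_assoc]
        _ = _ := by rw [hE.isIdempotentElem.eq]
    rw [Matrix.diagonal_mul_diagonal] at h1
    have h2 := congrFun (Matrix.diagonal_injective h1) i
    have h3 : d i * d i = d i := by exact_mod_cast h2
    exact mul_left_cancel₀ hi (h3.trans (mul_one _).symm)
  have hcard : Fintype.card {i // d i ≠ 0} = l := by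
    rw [← hl, hEh.rank_eq_card_non_zero_eigs]
    simp only [hd]
  let e : Fin l ≃ {i // d i ≠ 0} := (Fintype.equivFinOfCardEq hcard).symm
  -- The columns of `V` are the eigenvectors of `E` with eigenvalue `1`.
  refine ⟨U.submatrix id fun j => (e j : Fin n), ?_, ?_⟩
  · rw [Matrix.conjTranspose_submatrix, ← Matrix.submatrix_mul _ _ _ _ _ Function.bijective_id, hU,
      Matrix.submatrix_one (fun j => (e j : Fin n)) (Subtype.val_injective.comp e.injective)]
  · rw [hEd]
    ext i j
    rw [Matrix.mul_apply, Matrix.mul_apply]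
    simp only [Matrix.mul_diagonal, Matrix.submatrix_apply, Matrix.conjTranspose_apply, id]
    rw [Equiv.sum_comp e fun x : {i // d i ≠ 0} => U i x * star (U j x)]
    rw [← Finset.sum_subset (Finset.subset_univ (Finset.univ.filter fun i => d i ≠ 0)),
      Finset.sum_subtype (p := fun i => d i ≠ 0) _ (by simp)]
    · exact Finset.sum_congr rfl fun x _ => by rw [hd1 x x.2]; simp
    · intro x _ hx
      have : d x = 0 := by simpa using hx
      simp [this]

lemma prod_filter_eq_prod_castLE_rev {k : ℕ} (hkl : k ≤ l) (g : Fin l → ℝ) :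
    ∏ i ∈ Finset.univ.filter (fun i : Fin l => l - k ≤ i.val), g i =
      ∏ i : Fin k, g (Fin.castLE hkl i).rev := by
  have h : Finset.univ.filter (fun i : Fin l => l - k ≤ i.val) =
      Finset.univ.image fun i : Fin k => (Fin.castLE hkl i).rev := by
    ext i
    simp only [Finset.mem_filter, Finset.mem_univ, true_and, Finset.mem_image]
    constructor
    · intro hi
      refine ⟨⟨l - 1 - i, by omega⟩, ?_⟩
      ext
      simp only [Fin.val_rev, Fin.val_castLE]
      omega
    · rintro ⟨j, rfl⟩
      simp only [Fin.val_rev, Fin.val_castLE]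
      omega
  rw [h, Finset.prod_image fun a _ b _ hab =>
    Fin.castLE_injective hkl (Fin.rev_injective hab)]

/-- Powers of `A` are approximated from above by powers of `A + ε`, in diagonal form. -/
lemma tendsto_unitary_conj_diagonal_rpow {U : Matrix (Fin n) (Fin n) ℂ} (hU' : U * Uᴴ = 1)
    {a : Fin n → ℝ} (ha : ∀ i, 0 ≤ a i) {p : ℝ} (hp : 0 ≤ p) :
    Filter.Tendsto
      (fun ε : ℝ => U * Matrix.diagonal (fun i => (((a i + ε) ^ p : ℝ) : ℂ)) * Uᴴ) (𝓝[>] 0)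
      (𝓝[{X | X.PosDef ∧ U * Matrix.diagonal (fun i => ((a i ^ p : ℝ) : ℂ)) * Uᴴ ≤ X}]
        (U * Matrix.diagonal (fun i => ((a i ^ p : ℝ) : ℂ)) * Uᴴ)) := by
  refine tendsto_nhdsWithin_iff.mpr ⟨?_, ?_⟩
  · have hc : Continuous fun Y : Fin n → ℂ => U * Matrix.diagonal Y * Uᴴ := by fun_prop
    refine (hc.tendsto _).comp (tendsto_pi_nhds.mpr fun i => ?_)
    refine (Complex.continuous_ofReal.tendsto _).comp ?_
    have h1 : Filter.Tendsto (fun ε : ℝ => a i + ε) (𝓝[>] 0) (𝓝 (a i)) := by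
      have : Continuous fun ε : ℝ => a i + ε := by fun_prop
      have := this.tendsto 0
      rw [add_zero] at this
      exact this.mono_left nhdsWithin_le_nhds
    exact (Real.continuousAt_rpow_const (a i) p (Or.inr hp)).tendsto.comp h1
  · filter_upwards [self_mem_nhdsWithin] with ε hε
    replace hε : 0 < ε := hε
    refine ⟨posDef_unitary_conj_diagonal hU' fun i =>
      Real.rpow_pos_of_pos (add_pos_of_nonneg_of_pos (ha i) hε) p, ?_⟩
    have h1 : Matrix.diagonal (fun i => ((a i ^ p : ℝ) : ℂ)) ≤
        Matrix.diagonal (fun i => (((a i + ε) ^ p : ℝ) : ℂ)) := by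
      rw [Matrix.le_iff, Matrix.diagonal_sub]
      refine Matrix.PosSemidef.diagonal fun i => ?_
      have := Real.rpow_le_rpow (ha i) (le_add_of_nonneg_right hε.le : a i ≤ a i + ε) hp
      exact sub_nonneg.mpr (Complex.real_le_real.mpr this)
    have h2 := conj_le_conj h1 Uᴴ
    rwa [Matrix.conjTranspose_conjTranspose] at h2

end Projection

end LogMaj

theorem proposition4p6 {n l : ℕ} (A E : Matrix (Fin n) (Fin n) ℂ)
    (hA : A.PosSemidef) (hE : IsStarProjection E) (hl : E.rank = l)
    (α : ℝ) (hα0 : 0 < α) (hα1 : α ≤ 1)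
    (p₀ p₁ : ℝ) (hp₀ : 0 ≤ p₀) (hp₁ : 0 ≤ p₁)
    (θ : ℝ) (hθ0 : 0 ≤ θ) (hθ1 : θ ≤ 1) :
    -- the mean is a genuine limit, and it lives on the range of `E`
    (∀ p : ℝ, 0 ≤ p →
      Filter.Tendsto (LogMaj.geomMeanApprox α (LogMaj.mpow A p) E) (𝓝[>] (0 : ℝ))
        (𝓝 (LogMaj.geomMean α (LogMaj.mpow A p) E)) ∧
      (LogMaj.geomMean α (LogMaj.mpow A p) E).PosSemidef ∧
      E * LogMaj.geomMean α (LogMaj.mpow A p) E * E = LogMaj.geomMean α (LogMaj.mpow A p) E) ∧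
    LogMaj.LogSupermajorizedBy
      (fun i : Fin l =>
        LogMaj.eig (LogMaj.geomMean α (LogMaj.mpow A ((1 - θ) * p₀ + θ * p₁)) E) i)
      (fun i : Fin l =>
        LogMaj.eig (LogMaj.geomMean α (LogMaj.mpow A p₀) E) i ^ (1 - θ) *
          LogMaj.eig (LogMaj.geomMean α (LogMaj.mpow A p₁) E) i ^ θ) := by
  open LogMaj in
  have hA0 : 0 ≤ A := Matrix.nonneg_iff_posSemidef.mpr hA
  obtain ⟨V, hV, rfl⟩ := exists_isometry_of_isStarProjection hE hl
  have hln : l ≤ n := by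
    rw [← hl]
    simpa using Matrix.rank_le_card_width (V * Vᴴ)
  have hVinj := mulVec_injective_of_isometry hV
  obtain ⟨U, a, hU, hU', -, hAf, ha⟩ := exists_unitary_cfc_eq hA.1
  have ha0 : ∀ i, 0 ≤ a i := fun i => by rw [ha]; exact hA.eigenvalues_nonneg i
  choose L hL0 hLle hLlim using fun p : ℝ =>
    exists_tendsto_compressedMean hVinj hα0.le hα1 (mpow_nonneg hA0 p)
  have hlim : ∀ p, Filter.Tendsto (geomMeanApprox α (mpow A p) (V * Vᴴ)) (𝓝[>] 0)
      (𝓝 (V * L p * Vᴴ)) := fun p =>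
    tendsto_geomMeanApprox hα0 hα1 (mpow_nonneg hA0 p) (hLle p) (hLlim p)
  have hmean : ∀ p, geomMean α (mpow A p) (V * Vᴴ) = V * L p * Vᴴ := fun p => (hlim p).limUnder_eq
  refine ⟨fun p _ => ⟨?_, ?_, ?_⟩, fun k _ hkl => ?_⟩
  · rw [hmean]
    exact hlim p
  · rw [hmean]
    exact (Matrix.nonneg_iff_posSemidef.mp (hL0 p)).mul_mul_conjTranspose_same V
  · rw [hmean]
    calc _ = V * (Vᴴ * V) * L p * (Vᴴ * V) * Vᴴ := by simp only [Matrix.mul_assoc]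
      _ = _ := by rw [hV, Matrix.mul_one, Matrix.mul_one]
  · have heig : ∀ p (i : Fin l), eig (geomMean α (mpow A p) (V * Vᴴ)) i = eig (L p) i :=
      fun p i => by rw [hmean, eig_isometry_conj hV (hL0 p) hln i.2]
    simp only [heig]
    rw [prod_filter_eq_prod_castLE_rev hkl, prod_filter_eq_prod_castLE_rev hkl,
      Finset.prod_mul_distrib, Real.finsetProd_rpow _ _ fun i _ => eig_nonneg (hL0 _) _,
      Real.finsetProd_rpow _ _ fun i _ => eig_nonneg (hL0 _) _]
    set pθ := (1 - θ) * p₀ + θ * p₁ with hpθ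
    have hpθ0 : 0 ≤ pθ := by
      have : 0 ≤ 1 - θ := by linarith
      positivity
    -- The approximants `(A + ε)^p` share the eigenbasis `U` for all `p`, so interpolation in `p`
    -- applies to them for fixed `ε`.
    have hCX : ∀ {p : ℝ}, 0 ≤ p → Filter.Tendsto
        (fun ε : ℝ => U * Matrix.diagonal (fun i => (((a i + ε) ^ p : ℝ) : ℂ)) * Uᴴ) (𝓝[>] 0)
        (𝓝[{X | X.PosDef ∧ mpow A p ≤ X}] (mpow A p)) := fun {p} hp => by
      have := tendsto_unitary_conj_diagonal_rpow hU' ha0 hp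
      rwa [← hAf fun x => x ^ p] at this
    set K : ℝ → ℝ → Matrix (Fin l) (Fin l) ℂ := fun ε p => compressedMean α V
      (U * Matrix.diagonal (fun i => (((a i + ε) ^ p : ℝ) : ℂ)) * Uᴴ) with hK
    have hLK : ∀ {p : ℝ}, 0 ≤ p → ∀ᶠ ε in 𝓝[>] (0 : ℝ), L p ≤ K ε p := fun {p} hp =>
      ((tendsto_nhdsWithin_iff.mp (hCX hp)).2).mono fun ε h => hLle p _ h.1 h.2
    have hKlim : Filter.Tendsto (fun ε => K ε pθ) (𝓝[>] 0) (𝓝 (L pθ)) :=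
      (hLlim pθ).comp (hCX hpθ0)
    -- Writing the limiting bottom product as a determinant makes the passage to the limit a matter
    -- of continuity of `det`, not of eigenvalues.
    obtain ⟨Z, hZ, hZd⟩ := exists_isometry_det_eq (Matrix.nonneg_iff_posSemidef.mp (hL0 pθ)).1
      (f := fun i : Fin k => (Fin.castLE hkl i).rev)
      (Fin.rev_injective.comp (Fin.castLE_injective hkl))
    rw [← hZd]
    have hdet : Continuous fun Y : Matrix (Fin l) (Fin l) ℂ => (Zᴴ * Y * Z).det.re := by fun_prop
    refine ge_of_tendsto ((hdet.tendsto _).comp hKlim) ?_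
    filter_upwards [hLK hp₀, hLK hp₁, hLK hpθ0, self_mem_nhdsWithin] with ε h0 h1 hθ hε
    replace hε : 0 < ε := hε
    have h1θ : 0 ≤ 1 - θ := by linarith
    have hprod : ∀ {M : Matrix (Fin l) (Fin l) ℂ}, 0 ≤ M →
        0 ≤ ∏ i : Fin k, eig M (Fin.castLE hkl i).rev := fun hM =>
      Finset.prod_nonneg fun i _ => eig_nonneg hM _
    calc _ ≤ (∏ i : Fin k, eig (K ε p₀) (Fin.castLE hkl i).rev) ^ (1 - θ) *
          (∏ i : Fin k, eig (K ε p₁) (Fin.castLE hkl i).rev) ^ θ :=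
          mul_le_mul (Real.rpow_le_rpow (hprod (hL0 _)) (prod_eig_mono (hL0 _) h0 hkl) h1θ)
            (Real.rpow_le_rpow (hprod (hL0 _)) (prod_eig_mono (hL0 _) h1 hkl) hθ0)
            (Real.rpow_nonneg (hprod (hL0 _)) _)
            (Real.rpow_nonneg (hprod ((hL0 _).trans h0)) _)
      _ ≤ ∏ i : Fin k, eig (K ε pθ) (Fin.castLE hkl i).rev :=
          prod_eig_compressedMean_ge hU hU' (fun i => add_pos_of_nonneg_of_pos (ha0 i) hε) hV hα1
            hkl (fun _ => rfl) p₀ p₁ hθ0 hθ1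
      _ ≤ _ := (prod_eig_le_det_and_det_le_prod_eig ((hL0 _).trans hθ) hkl hZ).1
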